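/- For $q\in\mathbb C$ with $0<|q|<1$ and $x\in\mathbb C^*$ put $(x;q)=\prod_{i\ge 0}(1-xq^i)$ and $\theta(x)=(x;q)(q/x;q)$; signs $\pm$ in an argument of $\theta$ mean that the product over all choices of signs is taken, e.g. $\theta(x^{\pm})=\theta(x)\theta(x^{-1})$. For $v\in\mathbb C^*$ set $$I_{T_2}(x,y,z)=\frac1{\theta(v\,x^{\pm}y^{\pm}z^{\pm})},\qquad I_V(\xi)=(q;q)^2\,\theta(q/v^2)\,\theta(q\,\xi^{\pm2}/v^2)\,\theta(\xi^{\pm2}),$$ and define the elliptic genus of 2d $\mathcal N=(0,4)$ $SU(2)$ SQCD with four flavors by $$I(x,y,z,w)=\frac12\int_{\rm JK}\frac{d\xi}{2\pi i\,\xi}\;I_{T_2}(x,y,\xi)\,I_V(\xi)\,I_{T_2}(1/\xi,z,w).$$ Here $\int_{\rm JK}$ is the integral on the torus $\mathbb C^*/q^{\mathbb Z}$ over a contour that encircles exactly the poles coming from the fields of negative charge, i.e. it is the sum of the residues of the integrand (including the factor $1/\xi$) at the distinct points $\xi$ of the annulus $|q|<|\xi|\le1$ at which one of the eight factors $\theta(v\,x^{\pm}y^{\pm}\xi^{-1})$,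 $\theta(v\,z^{\pm}w^{\pm}\xi^{-1})$ vanishes; or, alternatively, the poles coming from the fields of positive charge, i.e. it is minus the sum of the residues at the points of that annulus at which one of the factors $\theta(v\,x^{\pm}y^{\pm}\xi)$, $\theta(v\,z^{\pm}w^{\pm}\xi)$ vanishes. **Theorem.** Let $0<|q|<1$ and let $v,x,y,z,w\in\mathbb C^*$ lie off the polar locus of the index, that is, $\theta(v^2)$, $\theta(v^2x^{\pm2})$, $\theta(v^2y^{\pm2})$, $\theta(v^2z^{\pm2})$, $\theta(v^2w^{\pm2})$ and $\theta(v^2x^{\pm}y^{\pm}z^{\pm}w^{\pm})$ are all nonzero. Then, for either of the two choices of contour, $I(x,y,z,w)$ is invariant under all permutations of $(x,y,z,w)$; in particular $I(x,y,z,w)=I(x,z,y,w)$. -/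

import Mathlib

open Filter Topology

namespace SQCDIndex

noncomputable section

/-- The infinite `q`-Pochhammer symbol `(x;q) = ∏_{i ≥ 0} (1 - x q^i)`. -/
def qPoch (x q : ℂ) : ℂ := ∏' i : ℕ, (1 - x * q ^ i)

/-- The theta function `θ(x;q) = (x;q) (q/x;q)`. -/
def theta (x q : ℂ) : ℂ := qPoch x q * qPoch (q / x) q

/-- The index of the trifundamental half-hypermultiplet, `1 / θ(v x^± y^± z^±)`: the product runs
over the eight choices of signs. -/
def indexT2 (x y z v q : ℂ) : ℂ :=
  1 / ∏ s : ℤˣ, ∏ t : ℤˣ, ∏ u : ℤˣ,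
    theta (v * x ^ (s : ℤ) * y ^ (t : ℤ) * z ^ (u : ℤ)) q

/-- The index of the `(0,4)` `SU(2)` vector multiplet,
`(q;q)² θ(q/v²) θ(q ξ^{±2}/v²) θ(ξ^{±2})`. -/
def indexV (ξ v q : ℂ) : ℂ :=
  qPoch q q ^ 2 * theta (q / v ^ 2) q *
    ∏ s : ℤˣ, theta (q * ξ ^ (2 * (s : ℤ)) / v ^ 2) q * theta (ξ ^ (2 * (s : ℤ))) q

/-- The integrand of the gauge theory index with respect to `dξ / (2πi ξ)`. -/
def integrand (x y z w v q ξ : ℂ) : ℂ :=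
  indexT2 x y ξ v q * indexV ξ v q * indexT2 ξ⁻¹ z w v q

/-- The residue of `f` at `c`: the limit of the integrals `(2πi)⁻¹ ∮ f(z) dz` over the
counterclockwise circles `|z - c| = r` as `r → 0+`. -/
def residue (f : ℂ → ℂ) (c : ℂ) : ℂ :=
  limUnder (𝓝[>] (0 : ℝ)) fun r : ℝ =>
    (2 * (Real.pi : ℂ) * Complex.I)⁻¹ * ∮ z in C(c, r), f z

/-- The points of the fundamental annulus `|q| < |ξ| ≤ 1` of the torus `ℂˣ / q^ℤ` at which the
one-loop factor `1 / θ(v x^± y^± ξ^ε)` or `1 / θ(v z^± w^± ξ^ε)` of a chiral field of charge `ε`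
under the Cartan subgroup of the gauge group is singular. -/
def chargedPoles (ε : ℤˣ) (x y z w v q : ℂ) : Set ℂ :=
  {ξ | ‖q‖ < ‖ξ‖ ∧ ‖ξ‖ ≤ 1 ∧
    ((∃ s t : ℤˣ, theta (v * x ^ (s : ℤ) * y ^ (t : ℤ) * ξ ^ (ε : ℤ)) q = 0) ∨
      (∃ s t : ℤˣ, theta (v * z ^ (s : ℤ) * w ^ (t : ℤ) * ξ ^ (ε : ℤ)) q = 0))}

/-- The elliptic genus of `SU(2)` SQCD with four flavors as a Jeffrey-Kirwan integral: one half of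
the integral of `integrand · dξ / (2πi ξ)` over a contour on the torus `ℂˣ / q^ℤ` that encircles
exactly the poles coming from the fields of charge `ε`. The contour has the orientation for which
the two choices `ε = 1` and `ε = -1` agree: counterclockwise around the poles for `ε = -1` and
clockwise for `ε = 1`. -/
def index (ε : ℤˣ) (x y z w v q : ℂ) : ℂ :=
  (1 / 2) * (-((ε : ℤ) : ℂ) *
    ∑ᶠ ξ ∈ chargedPoles ε x y z w v q, residue (fun ζ => integrand x y z w v q ζ / ζ) ξ)

/-- `a = (x, y, z, w)` lies off the polar locus of the index: `θ(v² a^λ) ≠ 0` for every weight `λ`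
of the adjoint representation `28 = (3,1,1,1) + (1,3,1,1) + (1,1,3,1) + (1,1,1,3) + (2,2,2,2)`
of `SO(8) ⊃ SU(2)⁴`. -/
structure IsRegular (a : Fin 4 → ℂ) (v q : ℂ) : Prop where
  zero_weight : theta (v ^ 2) q ≠ 0
  triplet : ∀ (i : Fin 4) (s : ℤˣ), theta (v ^ 2 * a i ^ (2 * (s : ℤ))) q ≠ 0
  doublets : ∀ s : Fin 4 → ℤˣ, theta (v ^ 2 * ∏ i, a i ^ (s i : ℤ)) q ≠ 0

end

end SQCDIndex

/-!
The integrand `F(ξ) dξ / ξ` is written in terms of the eight weights `a^j` of the vector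
representation of `SO(8)`: up to its numerator, `F` is `1 / ∏_j θ(v a^j ξ) θ(v a^j / ξ)`
(`gaugeIntegrand`). It is an elliptic function of `ξ`, symmetric under `ξ ↦ 1 / ξ`, and for generic
fugacities its poles of negative charge are the simple poles `ξ = v a^j`. After cancellation their
residues have, as functions of `u = v²`, poles only where `u a^m` is a power of `q` for some root
`m` of `SO(8)` (`residueTerm`).

For generic fugacities the sum of these eight residues is invariant under the permutations of the
four fugacities (`residueSum_comp_perm`). This is Liouville's theorem in the variable `u`: under
`u ↦ q u` every residue is multiplied by `-u / q²`, and at `u = a^{-m}`, where `m = j + k`, exactly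
the terms of the weights `j` and `k` have a pole. Both have the same residue, which depends on
nothing but the root `m` and the roots at an angle of `120` degrees with it
(`tendsto_sub_mul_residueSum`). Permutations of the four fugacities permute the roots and preserve
angles, so the difference of the two sums has only removable singularities. Multiplied by `u² θ(u)`
it is `q`-periodic and vanishes at `u = 1`, hence it is zero (`eq_of_periodic_of_removable`).

For arbitrary regular fugacities poles may collide, and the index is recovered as a limit of residue
sums along generic fugacities (`tendsto_residueSum`). Poles of the same charge that merge are
enclosed by a fixed small circle, on which the integrand converges uniformly. Regularity permits
poles of opposite charges to collide only for `v a^j` and `v⁻¹ a^{-j}`, at a point `ξ` for which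
`ξ²` is a power of `q`; there the zeros of the vector multiplet factor `θ(ξ^{±2})` remove the
singularity, and the residue of the deformed integrand tends to zero.
-/

namespace SQCDIndex

/-! ### The theta function -/

section Theta

variable {q x : ℂ}

lemma summable_norm_mul_pow (hq : ‖q‖ < 1) (x : ℂ) : Summable fun i : ℕ => ‖-(x * q ^ i)‖ := by
  simpa using (summable_geometric_of_lt_one (norm_nonneg q) hq).mul_left ‖x‖

lemma qPoch_eq_one_sub_mul (hq : ‖q‖ < 1) (x : ℂ) : qPoch x q = (1 - x) * qPoch (q * x) q := by
  have h (y : ℂ) : Multipliable fun i : ℕ => 1 - y * q ^ i := by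
    simpa [sub_eq_add_neg] using multipliable_one_add_of_summable (summable_norm_mul_pow hq y)
  have hs : (fun i : ℕ => 1 - x * q ^ (i + 1)) = fun i => 1 - q * x * q ^ i := by
    funext i; ring
  unfold qPoch
  rw [tprod_eq_zero_mul' (by rw [hs]; exact h _), hs]
  simp

lemma qPoch_ne_zero (hq : ‖q‖ < 1) (h : ∀ i : ℕ, x * q ^ i ≠ 1) : qPoch x q ≠ 0 := by
  have := tprod_one_add_ne_zero_of_summable (f := fun i : ℕ => -(x * q ^ i))
    (fun i hi => h i (by linear_combination -hi)) (summable_norm_mul_pow hq x)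
  simpa [qPoch, sub_eq_add_neg] using this

lemma differentiable_qPoch (hq : ‖q‖ < 1) : Differentiable ℂ fun x => qPoch x q := by
  intro x
  have hU : IsOpen (Metric.ball (0 : ℂ) (‖x‖ + 1)) := Metric.isOpen_ball
  have hs : Summable fun i : ℕ => (‖x‖ + 1) * ‖q‖ ^ i :=
    (summable_geometric_of_lt_one (norm_nonneg q) hq).mul_left _
  have hp := hs.hasProdLocallyUniformlyOn_nat_one_add (f := fun i y => -(y * q ^ i)) hU
    (.of_forall fun i y hy => by
      rw [norm_neg, norm_mul, norm_pow]
      have : ‖y‖ < ‖x‖ + 1 := by simpa using hy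
      gcongr) (fun i => by fun_prop)
  have hd := hp.differentiableOn (.of_forall fun s => by
    simpa [Finset.prod_fn] using DifferentiableOn.finsetProd (fun _ _ => by fun_prop)) hU
  have := hd.differentiableAt (hU.mem_nhds (x := x) (by simp))
  simpa [qPoch, sub_eq_add_neg] using this

lemma theta_eq_one_sub_mul (hq : ‖q‖ < 1) (x : ℂ) :
    theta x q = (1 - x) * (qPoch (q * x) q * qPoch (q / x) q) := by
  rw [theta, qPoch_eq_one_sub_mul hq x, mul_assoc]

lemma theta_q_mul (hq0 : q ≠ 0) (hq : ‖q‖ < 1) (hx : x ≠ 0) :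
    theta (q * x) q = -x⁻¹ * theta x q := by
  rw [theta_eq_one_sub_mul hq x, theta, show q / (q * x) = x⁻¹ by field_simp,
    qPoch_eq_one_sub_mul hq x⁻¹, ← div_eq_mul_inv]
  field_simp
  ring

lemma theta_inv (hq : ‖q‖ < 1) (hx : x ≠ 0) : theta x⁻¹ q = -x⁻¹ * theta x q := by
  rw [theta_eq_one_sub_mul hq x, theta_eq_one_sub_mul hq x⁻¹, div_inv_eq_mul, ← div_eq_mul_inv]
  field_simp
  ring

lemma theta_q_div (hq0 : q ≠ 0) (x : ℂ) : theta (q / x) q = theta x q := by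
  rw [theta, theta, div_div_cancel₀ hq0, mul_comm]

lemma theta_one (hq : ‖q‖ < 1) : theta 1 q = 0 := by
  simp [theta_eq_one_sub_mul hq]

lemma theta_zpow_mul_eq_zero_iff (hq0 : q ≠ 0) (hq : ‖q‖ < 1) (hx : x ≠ 0) (k : ℤ) :
    theta (q ^ k * x) q = 0 ↔ theta x q = 0 := by
  have h (y : ℂ) (hy : y ≠ 0) : theta (q * y) q = 0 ↔ theta y q = 0 := by
    simp [theta_q_mul hq0 hq hy, hy]
  induction k with
  | zero => simp
  | succ k ih =>
    refine Iff.trans ?_ ((h _ (mul_ne_zero (zpow_ne_zero _ hq0) hx)).trans ih)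
    rw [zpow_add_one₀ hq0, mul_comm _ q, mul_assoc]
  | pred k ih =>
    refine Iff.trans ((h _ (mul_ne_zero (zpow_ne_zero _ hq0) hx)).symm.trans ?_) ih
    rw [zpow_sub_one₀ hq0, ← mul_assoc, mul_comm q, inv_mul_cancel_right₀ hq0]

/-- The zeros of the theta function are the powers of `q`. -/
lemma theta_eq_zero_iff (hq0 : q ≠ 0) (hq : ‖q‖ < 1) (hx : x ≠ 0) :
    theta x q = 0 ↔ ∃ k : ℤ, x = q ^ k := by
  constructor
  · intro h
    rcases mul_eq_zero.1 h with h | h <;> by_contra! hk <;> refine qPoch_ne_zero hq ?_ h <;>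
      intro i hi
    · refine hk (-i) ?_
      rw [zpow_neg, zpow_natCast]
      exact eq_inv_of_mul_eq_one_left hi
    · refine hk (i + 1) ?_
      rw [zpow_add_one₀ hq0, zpow_natCast]
      field_simp at hi
      linear_combination -hi
  · rintro ⟨k, rfl⟩
    simpa [theta_one hq] using theta_zpow_mul_eq_zero_iff hq0 hq one_ne_zero k

lemma theta_inv_eq_zero_iff (hq : ‖q‖ < 1) (hx : x ≠ 0) : theta x⁻¹ q = 0 ↔ theta x q = 0 := by
  simp [theta_inv hq hx, hx]

/-- Multiplication by a zero of the theta function does not change whether theta vanishes. -/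
lemma theta_mul_eq_zero_iff (hq0 : q ≠ 0) (hq : ‖q‖ < 1) {y : ℂ} (hx : x ≠ 0) (hy : y ≠ 0)
    (h : theta y q = 0) : theta (y * x) q = 0 ↔ theta x q = 0 := by
  obtain ⟨k, rfl⟩ := (theta_eq_zero_iff hq0 hq hy).1 h
  exact theta_zpow_mul_eq_zero_iff hq0 hq hx k

lemma differentiableAt_theta (hq : ‖q‖ < 1) (hx : x ≠ 0) :
    DifferentiableAt ℂ (fun x => theta x q) x := by
  have := differentiable_qPoch hq
  unfold theta
  refine (this x).mul ?_
  exact (this (q / x)).comp (f := fun y => q / y) x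
    ((differentiableAt_const q).div differentiableAt_id hx)

lemma hasDerivAt_theta_one (hq : ‖q‖ < 1) :
    HasDerivAt (fun x => theta x q) (-qPoch q q ^ 2) 1 := by
  have hd : DifferentiableAt ℂ (fun x => qPoch (q * x) q * qPoch (q / x) q) 1 := by
    have := differentiable_qPoch hq
    refine DifferentiableAt.mul ?_ ?_
    · exact (this (q * 1)).comp (f := fun y => q * y) (1 : ℂ) (by fun_prop)
    · exact (this (q / 1)).comp (f := fun y => q / y) (1 : ℂ)
        ((differentiableAt_const q).div differentiableAt_id one_ne_zero)
  have := ((hasDerivAt_id (1 : ℂ)).const_sub 1).mul hd.hasDerivAt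
  rw [show (fun x => theta x q) = (fun x => 1 - id x) * fun x => qPoch (q * x) q * qPoch (q / x) q
    from funext fun x => theta_eq_one_sub_mul hq x]
  refine this.congr_deriv ?_
  simp
  ring

lemma qPoch_self_ne_zero (hq : ‖q‖ < 1) : qPoch q q ≠ 0 := by
  refine qPoch_ne_zero hq fun i hi => ?_
  have : ‖q‖ ^ (i + 1) = 1 := by
    rw [← norm_pow, pow_succ', hi, norm_one]
  exact absurd this (pow_lt_one₀ (norm_nonneg q) hq (by simp)).ne

/-- The zeros of the theta function are simple. -/
lemma deriv_theta_ne_zero (hq0 : q ≠ 0) (hq : ‖q‖ < 1) (hx : x ≠ 0) (h : theta x q = 0) :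
    deriv (fun x => theta x q) x ≠ 0 := by
  have step (y : ℂ) (hy : y ≠ 0) (h0 : theta y q = 0) :
      deriv (fun x => theta x q) (q * y) ≠ 0 ↔ deriv (fun x => theta x q) y ≠ 0 := by
    have h1 : HasDerivAt (fun x => theta (q * x) q) (deriv (fun x => theta x q) (q * y) * q) y :=
      HasDerivAt.comp (h := fun x => q * x) y
        (differentiableAt_theta hq (mul_ne_zero hq0 hy)).hasDerivAt
        (by simpa using (hasDerivAt_id y).const_mul q)
    have h2 := ((hasDerivAt_inv hy).neg).mul (differentiableAt_theta hq hy).hasDerivAt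
    have h3 := h1.congr_of_eventuallyEq (f₁ := fun x => -x⁻¹ * theta x q) (by
      filter_upwards [isOpen_ne.mem_nhds hy] with z hz
      exact (theta_q_mul hq0 hq hz).symm)
    have := h3.unique h2
    simp only [h0, mul_zero, zero_add, Pi.neg_apply] at this
    have h4 : deriv (fun x => theta x q) (q * y) =
        -(q⁻¹ * y⁻¹) * deriv (fun x => theta x q) y := by
      field_simp
      field_simp at this
      exact this
    rw [h4]
    simp [hq0, hy]
  obtain ⟨k, rfl⟩ := (theta_eq_zero_iff hq0 hq hx).1 h
  clear h hx
  have hz (k : ℤ) : theta (q ^ k) q = 0 :=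
    (theta_eq_zero_iff hq0 hq (zpow_ne_zero _ hq0)).2 ⟨k, rfl⟩
  induction k with
  | zero =>
    rw [zpow_zero, (hasDerivAt_theta_one hq).deriv]
    simpa using qPoch_self_ne_zero hq
  | succ k ih =>
    rw [zpow_add_one₀ hq0, mul_comm]
    exact (step _ (zpow_ne_zero _ hq0) (hz _)).2 ih
  | pred k ih =>
    refine (step _ (zpow_ne_zero _ hq0) (hz _)).1 ?_
    rwa [zpow_sub_one₀ hq0, mul_comm, inv_mul_cancel_right₀ hq0]

lemma continuousAt_theta_comp {X : Type*} [TopologicalSpace X] {g : X → ℂ} {p : X}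
    (hg : ContinuousAt g p) (hq : ‖q‖ < 1) (h0 : g p ≠ 0) :
    ContinuousAt (fun z => theta (g z) q) p :=
  (differentiableAt_theta hq h0).continuousAt.comp' hg

lemma differentiableAt_theta_comp {g : ℂ → ℂ} {p : ℂ} (hg : DifferentiableAt ℂ g p)
    (hq : ‖q‖ < 1) (h0 : g p ≠ 0) : DifferentiableAt ℂ (fun z => theta (g z) q) p :=
  (differentiableAt_theta hq h0).comp p hg

lemma tendsto_theta_comp_div_sub (hq : ‖q‖ < 1) {g : ℂ → ℂ} {g' p : ℂ} (hg : HasDerivAt g g' p)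
    (hp : g p ≠ 0) (h : theta (g p) q = 0) :
    Tendsto (fun z => theta (g z) q / (z - p)) (𝓝[≠] p)
      (𝓝 (deriv (fun x => theta x q) (g p) * g')) := by
  have := hasDerivAt_iff_tendsto_slope.1 ((differentiableAt_theta hq hp).hasDerivAt.comp p hg)
  refine this.congr fun z => ?_
  simp [slope, h, div_eq_inv_mul]

end Theta

/-! ### Isolated singularities and residues -/

section Residues

open Metric

variable {f : ℂ → ℂ} {c : ℂ}

lemma limUnder_punctured_eq (h : ContinuousAt f c) : limUnder (𝓝[≠] c) f = f c :=
  (h.tendsto.mono_left nhdsWithin_le_nhds).limUnder_eq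

lemma tendsto_limUnder_punctured (hd : ∀ᶠ z in 𝓝[≠] c, DifferentiableAt ℂ f z)
    (h0 : Tendsto (fun z => (z - c) * f z) (𝓝[≠] c) (𝓝 0)) :
    Tendsto f (𝓝[≠] c) (𝓝 (limUnder (𝓝[≠] c) f)) := by
  refine Complex.tendsto_limUnder_of_differentiable_on_punctured_nhds_of_isLittleO hd ?_
  have h1 : Tendsto (fun z => (z - c) * f c) (𝓝[≠] c) (𝓝 0) := by
    have : ContinuousAt (fun z => (z - c) * f c) c := by fun_prop
    simpa using this.tendsto.mono_left nhdsWithin_le_nhds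
  rw [Asymptotics.isLittleO_iff_tendsto']
  · have h2 := h0.sub h1
    rw [sub_zero] at h2
    refine h2.congr fun z => ?_
    rw [div_inv_eq_mul]
    ring
  · filter_upwards [self_mem_nhdsWithin] with z hz h
    exact absurd (inv_eq_zero.1 h) (sub_ne_zero.2 hz)

/-- Removable singularities can be removed simultaneously: the function `c ↦ lim_{z → c} f z` is
differentiable at every isolated singularity `c` of `f` at which `(z - c) f z → 0`. -/
lemma differentiableAt_limUnder_punctured (hd : ∀ᶠ z in 𝓝[≠] c, DifferentiableAt ℂ f z)
    (h0 : Tendsto (fun z => (z - c) * f z) (𝓝[≠] c) (𝓝 0)) :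
    DifferentiableAt ℂ (fun c => limUnder (𝓝[≠] c) f) c := by
  have hev : ∀ᶠ z in 𝓝[≠] c, f z = limUnder (𝓝[≠] z) f :=
    hd.mono fun z hz => (limUnder_punctured_eq hz.continuousAt).symm
  refine AnalyticAt.differentiableAt
    (Complex.analyticAt_of_differentiable_on_punctured_nhds_of_continuousAt ?_ ?_)
  · have h2 : ∀ᶠ z in 𝓝[≠] c, ∀ᶠ y in 𝓝 z, f y = limUnder (𝓝[≠] y) f := by
      rw [eventually_nhdsWithin_iff] at hev ⊢
      filter_upwards [hev.eventually_nhds] with z hz hzc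
      filter_upwards [hz, isOpen_ne.mem_nhds hzc] with y hy hyc using hy hyc
    filter_upwards [hd, h2] with z hz hz2
    exact (EventuallyEq.differentiableAt_iff hz2).1 hz
  · rw [continuousAt_iff_punctured_nhds]
    exact (tendsto_limUnder_punctured hd h0).congr' hev

/-- The residue theorem for a disc containing finitely many singularities, all of which are at most
simple poles. -/
lemma circleIntegral_eq_sum_of_simple_poles {r R : ℝ} (hr : 0 < r) (hrR : r < R) (S : Finset ℂ)
    (hS : ∀ p ∈ S, p ∈ ball c r) (hd : ∀ z ∈ ball c R, z ∉ S → DifferentiableAt ℂ f z) (ρ : ℂ → ℂ)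
    (hρ : ∀ p ∈ S, Tendsto (fun z => (z - p) * f z) (𝓝[≠] p) (𝓝 (ρ p))) :
    (∮ z in C(c, r), f z) = 2 * Real.pi * Complex.I * ∑ p ∈ S, ρ p := by
  set g : ℂ → ℂ := fun z => f z - ∑ p ∈ S, ρ p * (z - p)⁻¹ with hg
  have hgd : ∀ z ∈ ball c R, z ∉ S → DifferentiableAt ℂ g z := by
    intro z hz hzS
    refine (hd z hz hzS).sub (DifferentiableAt.fun_sum fun p hp => ?_)
    have : z - p ≠ 0 := sub_ne_zero.2 fun h => hzS (h ▸ hp)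
    fun_prop (disch := assumption)
  have hsub : closedBall c r ⊆ ball c R := closedBall_subset_ball hrR
  have hev (z : ℂ) (hz : z ∈ ball c R) : ∀ᶠ y in 𝓝[≠] z, DifferentiableAt ℂ g y := by
    have h1 : ∀ᶠ y in 𝓝[≠] z, y ∉ S := by
      have : IsOpen ((S.erase z : Finset ℂ) : Set ℂ)ᶜ :=
        (Finset.finite_toSet _).isClosed.isOpen_compl
      filter_upwards [self_mem_nhdsWithin, nhdsWithin_le_nhds
        (this.mem_nhds (x := z) (by simp))] with y hy1 hy2 hy3
      exact hy2 (by simpa using ⟨hy3, hy1⟩)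
    filter_upwards [h1, nhdsWithin_le_nhds (isOpen_ball.mem_nhds hz)] with y hy1 hy2
    exact hgd y hy2 hy1
  have h0 (z : ℂ) (hz : z ∈ ball c R) : Tendsto (fun y => (y - z) * g y) (𝓝[≠] z) (𝓝 0) := by
    by_cases hzS : z ∈ S
    · have h1 : ContinuousAt (fun y => (y - z) * ∑ p ∈ S.erase z, ρ p * (y - p)⁻¹) z := by
        refine ContinuousAt.mul (by fun_prop) (tendsto_finsetSum _ fun p hp => ?_)
        have : z - p ≠ 0 := sub_ne_zero.2 fun h => by simp [h] at hp
        have : ContinuousAt (fun y => ρ p * (y - p)⁻¹) z := by fun_prop (disch := assumption)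
        exact this
      have h2 := ((hρ z hzS).sub_const (ρ z)).sub (h1.tendsto.mono_left nhdsWithin_le_nhds)
      simp only [sub_self, zero_mul] at h2
      refine h2.congr' ?_
      filter_upwards [self_mem_nhdsWithin] with y hy
      have hy : y - z ≠ 0 := sub_ne_zero.2 hy
      simp only [hg]
      rw [← Finset.add_sum_erase S _ hzS]
      field_simp
      ring
    · have h1 : ContinuousAt (fun y => (y - z) * g y) z :=
        ContinuousAt.mul (by fun_prop) (hgd z hz hzS).continuousAt
      simpa using h1.tendsto.mono_left nhdsWithin_le_nhds
  have hext : ∀ z ∈ ball c R, DifferentiableAt ℂ (fun z => limUnder (𝓝[≠] z) g) z :=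
    fun z hz => differentiableAt_limUnder_punctured (hev z hz) (h0 z hz)
  have hsphere : ∀ z ∈ sphere c r, z ∉ S := fun z hz hzS => by
    have h1 := hS z hzS
    rw [mem_ball] at h1
    rw [mem_sphere] at hz
    exact h1.ne hz
  have hball : ∀ z ∈ sphere c r, z ∈ ball c R := fun z hz => hsub (sphere_subset_closedBall hz)
  have hI : (∮ z in C(c, r), g z) = 0 := by
    rw [circleIntegral.integral_congr (g := fun z => limUnder (𝓝[≠] z) g) hr.le fun z hz =>
      (limUnder_punctured_eq (hgd z (hball z hz) (hsphere z hz)).continuousAt).symm]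
    exact Complex.circleIntegral_eq_zero_of_differentiable_on_off_countable hr.le
      Set.countable_empty (fun z hz => (hext z (hsub hz)).continuousAt.continuousWithinAt)
      fun z hz => hext z (hsub (ball_subset_closedBall hz.1))
  have hfi : CircleIntegrable f c r := ContinuousOn.circleIntegrable hr.le fun z hz =>
    (hd z (hball z hz) (hsphere z hz)).continuousAt.continuousWithinAt
  have hpi (p : ℂ) (hp : p ∈ S) : CircleIntegrable (fun z => ρ p * (z - p)⁻¹) c r := by
    refine ContinuousOn.circleIntegrable hr.le fun z hz => ?_
    have : z - p ≠ 0 := sub_ne_zero.2 fun h => hsphere z hz (h ▸ hp)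
    have : ContinuousAt (fun z => ρ p * (z - p)⁻¹) z := by fun_prop (disch := assumption)
    exact this.continuousWithinAt
  have hsi : CircleIntegrable (fun z => ∑ p ∈ S, ρ p * (z - p)⁻¹) c r := by
    simpa [Finset.sum_fn] using CircleIntegrable.sum S hpi
  rw [hg, circleIntegral.integral_sub hfi hsi, sub_eq_zero, circleIntegral.integral_fun_sum hpi]
    at hI
  rw [hI, Finset.mul_sum]
  refine Finset.sum_congr rfl fun p hp => ?_
  rw [circleIntegral.integral_const_mul, circleIntegral.integral_sub_inv_of_mem_ball (hS p hp)]
  ring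

lemma residue_eq_circleIntegral {r R : ℝ} (hr : 0 < r) (hrR : r < R)
    (hd : ∀ z ∈ ball c R, z ≠ c → DifferentiableAt ℂ f z) :
    residue f c = (2 * (Real.pi : ℂ) * Complex.I)⁻¹ * ∮ z in C(c, r), f z := by
  refine Tendsto.limUnder_eq (tendsto_const_nhds.congr' ?_)
  filter_upwards [Ioc_mem_nhdsGT hr] with s hs
  congr 1
  refine Complex.circleIntegral_eq_of_differentiable_on_annulus_off_countable hs.1 hs.2
    Set.countable_empty (fun z hz => ?_) fun z hz => ?_
  · refine (hd z (closedBall_subset_ball hrR hz.1) ?_).continuousAt.continuousWithinAt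
    rintro rfl
    exact hz.2 (mem_ball_self hs.1)
  · refine hd z (ball_subset_ball hrR.le hz.1.1) ?_
    rintro rfl
    exact hz.1.2 (mem_closedBall_self hs.1.le)

lemma residue_eq_of_tendsto {ρ : ℂ} (hd : ∀ᶠ z in 𝓝[≠] c, DifferentiableAt ℂ f z)
    (hρ : Tendsto (fun z => (z - c) * f z) (𝓝[≠] c) (𝓝 ρ)) : residue f c = ρ := by
  obtain ⟨R, hR, hd⟩ := (nhdsWithin_hasBasis nhds_basis_ball _).eventually_iff.1 hd
  rw [residue_eq_circleIntegral (half_pos hR) (half_lt_self hR) fun z hz hzc => hd ⟨hz, hzc⟩,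
    circleIntegral_eq_sum_of_simple_poles (half_pos hR) (half_lt_self hR) {c}
      (by simpa using hR) (fun z hz hzc => hd ⟨hz, by simpa using hzc⟩) (fun _ => ρ)
      (by simpa using hρ)]
  have : (2 * Real.pi * Complex.I : ℂ) ≠ 0 := Complex.two_pi_I_ne_zero
  rw [Finset.sum_singleton, inv_mul_cancel_left₀ this]

end Residues

/-! ### Elliptic functions in multiplicative notation -/

section Elliptic

variable {q : ℂ}

lemma exists_zpow_mul_mem_annulus (hq0 : q ≠ 0) (hq : ‖q‖ < 1) {u : ℂ} (hu : u ≠ 0) :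
    ∃ k : ℤ, ‖q‖ < ‖q ^ k * u‖ ∧ ‖q ^ k * u‖ ≤ 1 := by
  have hq0' : 0 < ‖q‖ := norm_pos_iff.2 hq0
  obtain ⟨n, hn1, hn2⟩ := exists_mem_Ioc_zpow (norm_pos_iff.2 hu) ((one_lt_inv₀ hq0').2 hq)
  rw [inv_zpow'] at hn1 hn2
  refine ⟨n + 1, ?_, ?_⟩
  · rw [norm_mul, norm_zpow, zpow_add_one₀ hq0'.ne']
    have : ‖q‖ ^ n * ‖q‖ * ‖q‖ ^ (-n) = ‖q‖ := by
      rw [mul_right_comm, ← zpow_add₀ hq0'.ne', add_neg_cancel, zpow_zero, one_mul]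
    calc ‖q‖ = ‖q‖ ^ n * ‖q‖ * ‖q‖ ^ (-n) := this.symm
      _ < _ := by gcongr
  · rw [norm_mul, norm_zpow]
    calc _ ≤ ‖q‖ ^ (n + 1) * ‖q‖ ^ (-(n + 1)) := by gcongr
      _ = 1 := by rw [← zpow_add₀ hq0'.ne', add_neg_cancel, zpow_zero]

lemma eq_of_zpow_mul_mem_annulus (hq0 : q ≠ 0) (hq : ‖q‖ < 1) {u : ℂ} {k : ℤ}
    (h1 : ‖q‖ < ‖u‖) (h2 : ‖u‖ ≤ 1) (h3 : ‖q‖ < ‖q ^ k * u‖) (h4 : ‖q ^ k * u‖ ≤ 1) :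
    q ^ k * u = u := by
  have hq0' : 0 < ‖q‖ := norm_pos_iff.2 hq0
  have hu : 0 < ‖u‖ := hq0'.trans h1
  rw [norm_mul, norm_zpow] at h3 h4
  have hk1 : k < 1 := by
    by_contra! hk
    have : ‖q‖ ^ k ≤ ‖q‖ ^ (1 : ℤ) := zpow_le_zpow_right_of_le_one₀ hq0' hq.le hk
    rw [zpow_one] at this
    nlinarith
  have hk2 : -1 < k := by
    by_contra! hk
    have : ‖q‖ ^ (-1 : ℤ) ≤ ‖q‖ ^ k := zpow_le_zpow_right_of_le_one₀ hq0' hq.le hk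
    have h5 : ‖q‖ ^ (-1 : ℤ) * ‖u‖ ≤ 1 := le_trans (by gcongr) h4
    rw [zpow_neg_one, inv_mul_le_iff₀ hq0'] at h5
    linarith
  have : k = 0 := by omega
  simp [this]

lemma zpow_mul_periodic (hq0 : q ≠ 0) {E : ℂ → ℂ} (hE : ∀ u ≠ 0, E (q * u) = E u) (k : ℤ)
    {u : ℂ} (hu : u ≠ 0) : E (q ^ k * u) = E u := by
  induction k with
  | zero => simp
  | succ k ih =>
    rw [zpow_add_one₀ hq0, mul_comm _ q, mul_assoc, hE _ (mul_ne_zero (zpow_ne_zero _ hq0) hu), ih]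
  | pred k ih =>
    rw [← ih, ← hE _ (mul_ne_zero (zpow_ne_zero _ hq0) hu), zpow_sub_one₀ hq0, ← mul_assoc,
      mul_comm q, inv_mul_cancel_right₀ hq0]

/-- Multiplication by a nonzero constant maps punctured neighbourhoods to punctured
neighbourhoods. -/
lemma tendsto_const_mul_punctured {a : ℂ} (ha : a ≠ 0) (u : ℂ) :
    Tendsto (fun z => a * z) (𝓝[≠] u) (𝓝[≠] (a * u)) := by
  refine tendsto_nhdsWithin_iff.2 ⟨?_, ?_⟩
  · exact (continuous_const_mul a).continuousAt.tendsto.mono_left nhdsWithin_le_nhds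
  · filter_upwards [self_mem_nhdsWithin] with z hz h
    exact hz (mul_left_cancel₀ ha h)

lemma tendsto_sub_mul_of_zpow_mul (hq0 : q ≠ 0) {E : ℂ → ℂ} (hE : ∀ u ≠ 0, E (q * u) = E u)
    (k : ℤ) {u ρ : ℂ} (hu : u ≠ 0)
    (h : Tendsto (fun z => (z - q ^ k * u) * E z) (𝓝[≠] (q ^ k * u)) (𝓝 (q ^ k * ρ))) :
    Tendsto (fun z => (z - u) * E z) (𝓝[≠] u) (𝓝 ρ) := by
  have hk := zpow_ne_zero k hq0
  have h1 := (h.comp (tendsto_const_mul_punctured hk u)).const_mul (q ^ k)⁻¹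
  rw [inv_mul_cancel_left₀ hk] at h1
  refine h1.congr' ?_
  filter_upwards [nhdsWithin_le_nhds (isOpen_ne.mem_nhds hu)] with z hz
  simp only [Function.comp_apply]
  rw [zpow_mul_periodic hq0 hE k hz]
  field_simp

/-- Liouville's theorem on the torus `ℂˣ / q^ℤ`: a `q`-periodic function all of whose
singularities are removable is constant. -/
lemma eq_of_periodic_of_removable (hq0 : q ≠ 0) (hq : ‖q‖ < 1) {E : ℂ → ℂ}
    (hE : ∀ u ≠ 0, E (q * u) = E u) (hd : ∀ u ≠ 0, ∀ᶠ z in 𝓝[≠] u, DifferentiableAt ℂ E z)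
    (h0 : ∀ u ≠ 0, ∃ k : ℤ, Tendsto (fun z => (z - q ^ k * u) * E z) (𝓝[≠] (q ^ k * u)) (𝓝 0))
    {u₁ u₂ : ℂ} (hu₁ : u₁ ≠ 0) (hu₂ : u₂ ≠ 0) (hc₁ : ContinuousAt E u₁)
    (hc₂ : ContinuousAt E u₂) : E u₁ = E u₂ := by
  set G : ℂ → ℂ := fun u => limUnder (𝓝[≠] u) E with hG
  have h0' (u : ℂ) (hu : u ≠ 0) : Tendsto (fun z => (z - u) * E z) (𝓝[≠] u) (𝓝 0) := by
    obtain ⟨k, hk⟩ := h0 u hu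
    exact tendsto_sub_mul_of_zpow_mul hq0 hE k hu (by simpa using hk)
  have hGd (u : ℂ) (hu : u ≠ 0) : DifferentiableAt ℂ G u :=
    differentiableAt_limUnder_punctured (hd u hu) (h0' u hu)
  have hGE (u : ℂ) (hu : u ≠ 0) : G (q * u) = G u := by
    have h1 := (tendsto_limUnder_punctured (hd _ (mul_ne_zero hq0 hu))
      (h0' _ (mul_ne_zero hq0 hu))).comp (tendsto_const_mul_punctured hq0 u)
    refine (Tendsto.limUnder_eq (h1.congr' ?_)).symm
    filter_upwards [nhdsWithin_le_nhds (isOpen_ne.mem_nhds hu)] with z hz using hE z hz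
  have hK : IsCompact (Metric.closedBall (0 : ℂ) 1 \ Metric.ball 0 ‖q‖) :=
    (isCompact_closedBall 0 1).diff Metric.isOpen_ball
  have hGc : ContinuousOn G (Metric.closedBall (0 : ℂ) 1 \ Metric.ball 0 ‖q‖) := fun u hu => by
    refine (hGd u ?_).continuousAt.continuousWithinAt
    rintro rfl
    exact hu.2 (by simpa using hq0)
  have hb : Bornology.IsBounded (Set.range fun s => G (Complex.exp s)) := by
    refine (hK.image_of_continuousOn hGc).isBounded.subset ?_
    rintro _ ⟨s, rfl⟩
    obtain ⟨k, hk1, hk2⟩ := exists_zpow_mul_mem_annulus hq0 hq (Complex.exp_ne_zero s)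
    exact ⟨q ^ k * Complex.exp s, ⟨by simpa using hk2, by simpa using hk1.le⟩,
      zpow_mul_periodic hq0 hGE k (Complex.exp_ne_zero s)⟩
  have hdiff : Differentiable ℂ fun s => G (Complex.exp s) := fun s =>
    DifferentiableAt.comp (g := G) s (hGd _ (Complex.exp_ne_zero s))
      Complex.differentiable_exp.differentiableAt
  have := hdiff.apply_eq_apply_of_bounded hb (Complex.log u₁) (Complex.log u₂)
  rw [Complex.exp_log hu₁, Complex.exp_log hu₂, hG] at this
  simpa only [limUnder_punctured_eq hc₁, limUnder_punctured_eq hc₂] using this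

end Elliptic

/-! ### Weights of the flavor symmetry -/

/-- The eight weights of the vector representation `8 = (2,2,1,1) + (1,1,2,2)` of `SO(8)`: the
first entry chooses the summand, the other two the signs of the weights of the two doublets. -/
abbrev VectorWeight := Bool × ℤˣ × ℤˣ

/-- The negative of a weight of the vector representation. -/
def VectorWeight.conj (j : VectorWeight) : VectorWeight := (j.1, -j.2.1, -j.2.2)

/-- The coordinates of a weight of the vector representation with respect to `SU(2)⁴`. -/
def VectorWeight.coords : VectorWeight → Fin 4 → ℤ
  | (true, s, t) => ![s, t, 0, 0]
  | (false, s, t) => ![0, 0, s, t]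

/-- The weights of the vector representation other than `j` and `-j`. -/
def VectorWeight.others (j : VectorWeight) : Finset VectorWeight :=
  Finset.univ.filter fun k => k ≠ j ∧ k ≠ j.conj

/-- The roots of `SO(8)`: in the coordinates with respect to `SU(2)⁴` these are the integer vectors
of square length `4`, that is, `(±2,0,0,0)` up to permutations and `(±1,±1,±1,±1)`. -/
noncomputable def roots : Finset (Fin 4 → ℤ) :=
  (Fintype.piFinset fun _ => Finset.Icc (-2) 2).filter fun m => ∑ i, m i ^ 2 = 4

/-- The roots at an angle of `120` degrees with the root `m`. -/
noncomputable def obtuseRoots (m : Fin 4 → ℤ) : Finset (Fin 4 → ℤ) :=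
  roots.filter fun n => ∑ i, n i * m i = -2

namespace VectorWeight

lemma conj_conj (j : VectorWeight) : j.conj.conj = j := by
  simp [conj]

lemma coords_conj (j : VectorWeight) : j.conj.coords = -j.coords := by
  revert j; decide +kernel

lemma coords_injective : Function.Injective coords := by
  unfold Function.Injective; decide +kernel

lemma abs_coords_le (j : VectorWeight) (i : Fin 4) : |j.coords i| ≤ 1 := by
  revert j i; decide +kernel

lemma card_others (j : VectorWeight) : j.others.card = 6 := by
  revert j; decide +kernel

lemma sum_coords_others (j : VectorWeight) : ∑ k ∈ j.others, k.coords = 0 := by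
  revert j; decide +kernel

set_option synthInstance.maxHeartbeats 200000 in
set_option synthInstance.maxSize 1000 in
/-- A root is the sum of two weights of the vector representation in only one way, up to order. -/
lemma coords_add_coords_inj : ∀ i l j k : VectorWeight, l ∈ i.others → k ∈ j.others →
    i.coords + l.coords = j.coords + k.coords → i = j ∨ i = k := by
  decide +kernel

lemma exists_coords_add_coords : ∀ m ∈ roots, ∃ j k : VectorWeight, k ∈ j.others ∧
    m = j.coords + k.coords := by
  decide +kernel

/-- The roots at an angle of `120` degrees with `j + k` are `l - k` and `l - j`, where `l` runs over
the weights other than `±j` and `±k`. -/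
lemma obtuseRoots_eq : ∀ j k : VectorWeight, k ∈ j.others →
    (obtuseRoots (j.coords + k.coords)).val =
      ((j.others ∩ k.others).val.map fun l => l.coords - k.coords) +
        (j.others ∩ k.others).val.map fun l => l.coords - j.coords := by
  decide +kernel

lemma others_eq_insert : ∀ j k : VectorWeight, k ∈ j.others →
    j.others = insert k (insert k.conj (j.others ∩ k.others)) ∧
      k ∉ insert k.conj (j.others ∩ k.others) ∧ k.conj ∉ j.others ∩ k.others := by
  decide +kernel

lemma mem_others_symm : ∀ j k : VectorWeight, k ∈ j.others → j ∈ k.others := by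
  decide +kernel

lemma mem_others : ∀ j k : VectorWeight, k ∈ j.others ↔ k ≠ j ∧ k ≠ j.conj := by
  decide +kernel

lemma conj_ne : ∀ j : VectorWeight, j.conj ≠ j := by
  decide +kernel

end VectorWeight
section Monomial

variable {a : Fin 4 → ℂ}

/-- The monomial `a^m = ∏ aᵢ^{mᵢ}`. -/
noncomputable def mon (a : Fin 4 → ℂ) (m : Fin 4 → ℤ) : ℂ := ∏ i, a i ^ m i

lemma mon_ne_zero (ha : ∀ i, a i ≠ 0) (m : Fin 4 → ℤ) : mon a m ≠ 0 :=
  Finset.prod_ne_zero_iff.2 fun i _ => zpow_ne_zero _ (ha i)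

lemma mon_zero (a : Fin 4 → ℂ) : mon a 0 = 1 := by simp [mon]

lemma mon_add (ha : ∀ i, a i ≠ 0) (m n : Fin 4 → ℤ) : mon a (m + n) = mon a m * mon a n := by
  simp [mon, zpow_add₀ (ha _), Finset.prod_mul_distrib]

lemma mon_neg (a : Fin 4 → ℂ) (m : Fin 4 → ℤ) : mon a (-m) = (mon a m)⁻¹ := by
  simp [mon]

lemma mon_sub (ha : ∀ i, a i ≠ 0) (m n : Fin 4 → ℤ) : mon a (m - n) = mon a m / mon a n := by
  rw [sub_eq_add_neg, mon_add ha, mon_neg, div_eq_mul_inv]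

lemma mon_sum (ha : ∀ i, a i ≠ 0) {ι : Type*} (s : Finset ι) (m : ι → Fin 4 → ℤ) :
    mon a (∑ k ∈ s, m k) = ∏ k ∈ s, mon a (m k) := by
  classical
  induction s using Finset.induction_on with
  | empty => simp [mon_zero]
  | insert k s hk ih => rw [Finset.sum_insert hk, Finset.prod_insert hk, mon_add ha, ih]

lemma mon_comp_perm (a : Fin 4 → ℂ) (m : Fin 4 → ℤ) (σ : Equiv.Perm (Fin 4)) :
    mon (a ∘ σ) (m ∘ σ) = mon a m :=
  Equiv.prod_comp σ fun i => a i ^ m i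

/-- The fugacity `a^j` of the component of weight `j` of the vector representation. -/
noncomputable def fug (a : Fin 4 → ℂ) (j : VectorWeight) : ℂ := mon a j.coords

lemma fug_ne_zero (ha : ∀ i, a i ≠ 0) (j : VectorWeight) : fug a j ≠ 0 := mon_ne_zero ha _

lemma fug_conj (a : Fin 4 → ℂ) (j : VectorWeight) : fug a j.conj = (fug a j)⁻¹ := by
  rw [fug, j.coords_conj, mon_neg, fug]

/-- Fugacities are generic if no nontrivial monomial of small degree in them is a power of `q`. -/
def IsGeneric (a : Fin 4 → ℂ) (q : ℂ) : Prop :=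
  ∀ m : Fin 4 → ℤ, m ≠ 0 → (∀ i, |m i| ≤ 4) → theta (mon a m) q ≠ 0

lemma IsGeneric.comp_perm {q : ℂ} (h : IsGeneric a q) (σ : Equiv.Perm (Fin 4)) :
    IsGeneric (a ∘ σ) q := by
  intro m hm hm4
  have h1 : m = (m ∘ σ.symm) ∘ σ := by ext; simp
  rw [h1, mon_comp_perm]
  refine h _ (fun h0 => hm ?_) fun i => hm4 _
  rw [h1, h0]; rfl

end Monomial

/-! ### The residue sum -/

section ResidueSum

open VectorWeight

variable {a : Fin 4 → ℂ} {q u : ℂ} {j k : VectorWeight}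

/-- The residue of the integrand at `ξ = v a^j`, as a function of `u = v²`. -/
noncomputable def residueTerm (a : Fin 4 → ℂ) (u q : ℂ) (j : VectorWeight) : ℂ :=
  theta (u ^ 2 * fug a j ^ 2) q * theta (u * fug a j ^ 2)⁻¹ q /
    ∏ k ∈ j.others, theta (u * fug a j * fug a k) q * theta (fug a k / fug a j) q

/-- The residue of `residueTerm a u q j` and of `residueTerm a u q k`, as functions of `u`, at the
pole `u = a^{-m}`, where `m = j + k`. It depends only on the root `m`. -/
noncomputable def rootResidue (a : Fin 4 → ℂ) (q : ℂ) (m : Fin 4 → ℤ) : ℂ :=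
  (mon a m)⁻¹ * (-qPoch q q ^ 2)⁻¹ /
    (theta (mon a m)⁻¹ q * ∏ n ∈ obtuseRoots m, theta (mon a n) q)

lemma rootResidue_comp_perm (a : Fin 4 → ℂ) (q : ℂ) (m : Fin 4 → ℤ) (σ : Equiv.Perm (Fin 4)) :
    rootResidue (a ∘ σ) q (m ∘ σ) = rootResidue a q m := by
  have : ∏ n ∈ obtuseRoots (m ∘ σ), theta (mon (a ∘ σ) n) q =
      ∏ n ∈ obtuseRoots m, theta (mon a n) q := by
    symm
    refine Finset.prod_bij' (fun n _ => n ∘ σ) (fun n _ => n ∘ σ.symm) ?_ ?_ ?_ ?_ ?_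
    · intro n hn
      simp only [obtuseRoots, roots, Finset.mem_filter, Fintype.mem_piFinset] at hn ⊢
      exact ⟨⟨fun i => hn.1.1 (σ i), (Equiv.sum_comp σ fun i => n i ^ 2).trans hn.1.2⟩,
        (Equiv.sum_comp σ fun i => n i * m i).trans hn.2⟩
    · intro n hn
      simp only [obtuseRoots, roots, Finset.mem_filter, Fintype.mem_piFinset] at hn ⊢
      refine ⟨⟨fun i => hn.1.1 (σ.symm i), (Equiv.sum_comp σ.symm fun i => n i ^ 2).trans hn.1.2⟩,
        Eq.trans ?_ hn.2⟩
      rw [← Equiv.sum_comp σ.symm fun i => n i * (m ∘ σ) i]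
      simp
    · intro n _; ext; simp
    · intro n _; ext; simp
    · intro n _; rw [mon_comp_perm]
  rw [rootResidue, rootResidue, mon_comp_perm, this]

lemma theta_div_fug_ne_zero (ha : ∀ i, a i ≠ 0) (h : IsGeneric a q) (hjk : k ≠ j) :
    theta (fug a k / fug a j) q ≠ 0 := by
  rw [fug, fug, ← mon_sub ha]
  refine h _ (fun h0 => hjk (coords_injective (sub_eq_zero.1 h0))) fun i => ?_
  have := (abs_sub (k.coords i) (j.coords i)).trans
    (add_le_add (k.abs_coords_le i) (j.abs_coords_le i))
  exact this.trans (by norm_num)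

lemma prod_fug_others (ha : ∀ i, a i ≠ 0) (j : VectorWeight) : ∏ k ∈ j.others, fug a k = 1 := by
  simp only [fug, ← mon_sum ha, sum_coords_others, mon_zero]

lemma residueTerm_q_mul (hq0 : q ≠ 0) (hq : ‖q‖ < 1) (ha : ∀ i, a i ≠ 0) (hu : u ≠ 0)
    (j : VectorWeight) :
    residueTerm a (q * u) q j = -(u / q ^ 2) * residueTerm a u q j := by
  have hj := fug_ne_zero ha j
  have h1 : theta ((q * u) ^ 2 * fug a j ^ 2) q =
      q⁻¹ * (u ^ 2 * fug a j ^ 2)⁻¹ ^ 2 * theta (u ^ 2 * fug a j ^ 2) q := by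
    rw [show (q * u) ^ 2 * fug a j ^ 2 = q * (q * (u ^ 2 * fug a j ^ 2)) by ring,
      theta_q_mul hq0 hq (by positivity), theta_q_mul hq0 hq (by positivity)]
    field_simp
  have h2 : theta (q * u * fug a j ^ 2)⁻¹ q =
      -(q * u * fug a j ^ 2)⁻¹ * theta (u * fug a j ^ 2)⁻¹ q := by
    rw [show (u * fug a j ^ 2)⁻¹ = q * (q * u * fug a j ^ 2)⁻¹ by field_simp,
      theta_q_mul hq0 hq (by positivity)]
    field_simp
  have h3 : ∏ k ∈ j.others, theta (q * u * fug a j * fug a k) q * theta (fug a k / fug a j) q =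
      (u * fug a j)⁻¹ ^ 6 *
        ∏ k ∈ j.others, theta (u * fug a j * fug a k) q * theta (fug a k / fug a j) q := by
    have h4 (k : VectorWeight) : theta (q * u * fug a j * fug a k) q * theta (fug a k / fug a j) q =
        -(u * fug a j)⁻¹ * (fug a k)⁻¹ *
          (theta (u * fug a j * fug a k) q * theta (fug a k / fug a j) q) := by
      have := fug_ne_zero ha k
      rw [show q * u * fug a j * fug a k = q * (u * fug a j * fug a k) by ring,
        theta_q_mul hq0 hq (by positivity)]
      field_simp
    rw [Finset.prod_congr rfl fun k _ => h4 k, Finset.prod_mul_distrib, Finset.prod_mul_distrib,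
      Finset.prod_const, card_others, Finset.prod_inv_distrib, prod_fug_others ha]
    ring
  rw [residueTerm, residueTerm, h1, h2, h3]
  field_simp

lemma differentiableAt_residueTerm (hq : ‖q‖ < 1) (ha : ∀ i, a i ≠ 0) (hu : u ≠ 0)
    (h : ∀ k ∈ j.others, theta (u * fug a j * fug a k) q * theta (fug a k / fug a j) q ≠ 0) :
    DifferentiableAt ℂ (fun u => residueTerm a u q j) u := by
  have hj := fug_ne_zero ha j
  have hk := fug_ne_zero ha
  refine DifferentiableAt.div (DifferentiableAt.mul ?_ ?_) (DifferentiableAt.fun_finsetProd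
    fun k hk' => DifferentiableAt.mul ?_ ?_) (Finset.prod_ne_zero_iff.2 h)
  · exact differentiableAt_theta_comp (by fun_prop) hq (by positivity)
  · exact differentiableAt_theta_comp (by fun_prop (disch := positivity)) hq (by positivity)
  · have := hk k
    exact differentiableAt_theta_comp (by fun_prop) hq (by positivity)
  · fun_prop

lemma tendsto_sub_inv_div_theta_mul (hq : ‖q‖ < 1) {c : ℂ} (hc : c ≠ 0) :
    Tendsto (fun u => (u - c⁻¹) / theta (c * u) q) (𝓝[≠] c⁻¹)
      (𝓝 (c⁻¹ * (-qPoch q q ^ 2)⁻¹)) := by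
  have h1 : c * c⁻¹ = 1 := mul_inv_cancel₀ hc
  have := tendsto_theta_comp_div_sub hq (p := c⁻¹) (by simpa using (hasDerivAt_id c⁻¹).const_mul c)
    (by simp [h1]) (by simp [h1, theta_one hq])
  simp only [h1, (hasDerivAt_theta_one hq).deriv] at this
  have h2 := this.inv₀ (mul_ne_zero (by simpa using qPoch_self_ne_zero hq) hc)
  refine (h2.congr fun z => ?_).trans_eq ?_
  · rw [inv_div]
  · rw [mul_inv, mul_comm]

lemma prod_theta_obtuseRoots (ha : ∀ i, a i ≠ 0) (hk : k ∈ j.others) :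
    ∏ n ∈ obtuseRoots (j.coords + k.coords), theta (mon a n) q =
      ∏ l ∈ j.others ∩ k.others, theta (fug a l / fug a k) q * theta (fug a l / fug a j) q := by
  rw [Finset.prod, obtuseRoots_eq j k hk]
  simp [Finset.prod, mon_sub ha, fug]

/-- The pole of a residue term at `u = a^{-m}` for a root `m = j + k`. There `u a^j = a^{-k}`, so
that the numerator cancels two of the factors that do not vanish, and the others are symmetric in
`j` and `k`. -/
lemma tendsto_sub_mul_residueTerm (hq : ‖q‖ < 1) (ha : ∀ i, a i ≠ 0) (h : IsGeneric a q)
    (hk : k ∈ j.others) :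
    Tendsto (fun u => (u - (mon a (j.coords + k.coords))⁻¹) * residueTerm a u q j)
      (𝓝[≠] (mon a (j.coords + k.coords))⁻¹)
      (𝓝 (rootResidue a q (j.coords + k.coords))) := by
  have hf := fug_ne_zero ha
  have hj := hf j
  have hk0 := hf k
  obtain ⟨hins, hk1, hk2⟩ := others_eq_insert j k hk
  obtain ⟨hkj, hkj'⟩ := (mem_others j k).1 hk
  have hjk' : k.conj ≠ j := fun h0 => hkj' (by rw [← h0, conj_conj])
  rw [rootResidue, prod_theta_obtuseRoots ha hk, mon_add ha, ← fug, ← fug]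
  set u₀ := (fug a j * fug a k)⁻¹ with hu₀
  have hu₀0 : u₀ ≠ 0 := by positivity
  set g : ℂ → ℂ := fun u => theta (u ^ 2 * fug a j ^ 2) q * theta (u * fug a j ^ 2)⁻¹ q /
    (theta (fug a k / fug a j) q *
      ∏ l ∈ insert k.conj (j.others ∩ k.others),
        theta (u * fug a j * fug a l) q * theta (fug a l / fug a j) q) with hg
  have hu1 (l : VectorWeight) : u₀ * fug a j * fug a l = fug a l / fug a k := by
    rw [hu₀]; field_simp
  have hcont : ContinuousAt g u₀ := by
    refine ContinuousAt.div (ContinuousAt.mul ?_ ?_) (ContinuousAt.mul (by fun_prop)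
      (tendsto_finsetProd _ fun l _ => ContinuousAt.mul ?_ (by fun_prop)))
      (mul_ne_zero (theta_div_fug_ne_zero ha h hkj) (Finset.prod_ne_zero_iff.2 fun l hl => ?_))
    · exact continuousAt_theta_comp (by fun_prop) hq (by positivity)
    · exact continuousAt_theta_comp (by fun_prop (disch := positivity)) hq (by positivity)
    · have := hf l
      exact continuousAt_theta_comp (by fun_prop) hq (by positivity)
    · rw [hu1]
      refine mul_ne_zero (theta_div_fug_ne_zero ha h ?_) (theta_div_fug_ne_zero ha h ?_)
      · rintro rfl; exact hk1 hl
      · rcases Finset.mem_insert.1 hl with rfl | hl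
        · exact hjk'
        · exact ((mem_others _ _).1 (Finset.mem_inter.1 hl).1).1
  have hlim := (tendsto_sub_inv_div_theta_mul hq (mul_ne_zero hj hk0)).mul
    (hcont.tendsto.mono_left nhdsWithin_le_nhds)
  have h1 : theta (u₀ ^ 2 * fug a j ^ 2) q = theta (fug a k.conj / fug a k) q := by
    rw [fug_conj, hu₀]; congr 1; field_simp
  have h2 : theta (u₀ * fug a j ^ 2)⁻¹ q = theta (fug a k / fug a j) q := by
    rw [hu₀]; congr 1; field_simp
  have h3 : theta (fug a k.conj / fug a j) q = theta (fug a j * fug a k)⁻¹ q := by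
    rw [fug_conj]; congr 1; field_simp
  have h4 := theta_div_fug_ne_zero ha h hkj
  have h5 := theta_div_fug_ne_zero ha h k.conj_ne
  refine (hlim.congr' ?_).trans_eq ?_
  · refine Eventually.of_forall fun u => ?_
    change _ = (u - u₀) * residueTerm a u q j
    rw [residueTerm, hins, Finset.prod_insert hk1, hg]
    simp only [div_eq_mul_inv, mul_inv]
    rw [show fug a j * fug a k * u = u * fug a j * fug a k by ring]
    ring
  · rw [hg]
    simp only [hu1, h1, h2, Finset.prod_insert hk2, h3]
    have key (x A B C P : ℂ) (hA : A ≠ 0) (hB : B ≠ 0) :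
        x * (A * B / (B * (A * C * P))) = x / (C * P) := by field_simp
    exact congrArg _ (key _ _ _ _ _ h5 h4)

/-- The sum of the residues of the integrand at the poles `ξ = v a^j`. -/
noncomputable def residueSum (a : Fin 4 → ℂ) (u q : ℂ) : ℂ :=
  ∑ j : VectorWeight, residueTerm a u q j

lemma theta_fug_mul_fug_div_ne_zero (ha : ∀ i, a i ≠ 0) (h : IsGeneric a q)
    (hk : k ∈ j.others) {i l : VectorWeight} (hl : l ∈ i.others) (hij : i ≠ j) (hik : i ≠ k) :
    theta ((fug a j * fug a k)⁻¹ * fug a i * fug a l) q ≠ 0 := by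
  rw [show (fug a j * fug a k)⁻¹ * fug a i * fug a l =
    mon a (i.coords + l.coords - (j.coords + k.coords)) by
      rw [mon_sub ha, mon_add ha, mon_add ha]; simp only [fug]; ring]
  refine h _ (fun h0 => ?_) fun n => ?_
  · rcases coords_add_coords_inj i l j k hl hk (sub_eq_zero.1 h0) with h1 | h1
    exacts [hij h1, hik h1]
  · have h1 := abs_le.1 (i.abs_coords_le n)
    have h2 := abs_le.1 (l.abs_coords_le n)
    have h3 := abs_le.1 (j.abs_coords_le n)
    have h4 := abs_le.1 (k.abs_coords_le n)
    simp only [Pi.sub_apply, Pi.add_apply]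
    rw [abs_le]
    constructor <;> linarith

lemma mem_roots_iff_exists (m : Fin 4 → ℤ) :
    m ∈ roots ↔ ∃ j k : VectorWeight, k ∈ j.others ∧ m = j.coords + k.coords := by
  refine ⟨exists_coords_add_coords m, ?_⟩
  rintro ⟨j, k, hk, rfl⟩
  revert j k
  decide +kernel

/-- The pole of the residue sum at `u = a^{-m}` for a root `m`: precisely two of the eight terms
contribute, and they contribute equally. -/
lemma tendsto_sub_mul_residueSum (hq : ‖q‖ < 1) (ha : ∀ i, a i ≠ 0) (h : IsGeneric a q)
    {m : Fin 4 → ℤ} (hm : m ∈ roots) :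
    Tendsto (fun u => (u - (mon a m)⁻¹) * residueSum a u q) (𝓝[≠] (mon a m)⁻¹)
      (𝓝 (2 * rootResidue a q m)) := by
  obtain ⟨j, k, hk, rfl⟩ := (mem_roots_iff_exists m).1 hm
  have hkj := ((mem_others _ _).1 hk).1
  simp only [residueSum, Finset.mul_sum]
  have h2 : 2 * rootResidue a q (j.coords + k.coords) = ∑ i : VectorWeight,
      if i = j ∨ i = k then rootResidue a q (j.coords + k.coords) else 0 := by
    rw [← Finset.sum_filter, Finset.filter_or, Finset.sum_union (by
      rw [Finset.disjoint_filter]; rintro i - rfl; exact hkj.symm)]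
    simp [Finset.filter_eq', two_mul]
  rw [h2]
  refine tendsto_finsetSum _ fun i _ => ?_
  split_ifs with hi
  · rcases hi with rfl | rfl
    · exact tendsto_sub_mul_residueTerm hq ha h hk
    · rw [add_comm]
      exact tendsto_sub_mul_residueTerm hq ha h (mem_others_symm _ _ hk)
  · push Not at hi
    have hu : (mon a (j.coords + k.coords))⁻¹ ≠ 0 := inv_ne_zero (mon_ne_zero ha _)
    have hc := (differentiableAt_residueTerm (j := i) hq ha hu fun l hl => mul_ne_zero (by
      rw [mon_add ha]
      exact theta_fug_mul_fug_div_ne_zero ha h hk hl hi.1 hi.2)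
        (theta_div_fug_ne_zero ha h ((mem_others _ _).1 hl).1)).continuousAt
    have hc' : ContinuousAt (fun u => (u - (mon a (j.coords + k.coords))⁻¹) *
      residueTerm a u q i) (mon a (j.coords + k.coords))⁻¹ := ContinuousAt.mul (by fun_prop) hc
    simpa using hc'.tendsto.mono_left nhdsWithin_le_nhds

lemma residueSum_q_mul (hq0 : q ≠ 0) (hq : ‖q‖ < 1) (ha : ∀ i, a i ≠ 0) (hu : u ≠ 0) :
    residueSum a (q * u) q = -(u / q ^ 2) * residueSum a u q := by
  simp only [residueSum, Finset.mul_sum, residueTerm_q_mul hq0 hq ha hu]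

lemma differentiableAt_residueSum (hq : ‖q‖ < 1) (ha : ∀ i, a i ≠ 0) (h : IsGeneric a q)
    (hu : u ≠ 0) (hm : ∀ m ∈ roots, theta (mon a m * u) q ≠ 0) :
    DifferentiableAt ℂ (fun u => residueSum a u q) u := by
  refine DifferentiableAt.fun_sum fun j _ => differentiableAt_residueTerm hq ha hu fun k hk =>
    mul_ne_zero ?_ (theta_div_fug_ne_zero ha h ((mem_others _ _).1 hk).1)
  have := hm _ ((mem_roots_iff_exists _).2 ⟨j, k, hk, rfl⟩)
  rwa [mon_add ha, ← fug, ← fug, mul_comm, ← mul_assoc] at this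

lemma comp_perm_mem_roots {m : Fin 4 → ℤ} (hm : m ∈ roots) (σ : Equiv.Perm (Fin 4)) :
    m ∘ σ ∈ roots := by
  simp only [roots, Finset.mem_filter, Fintype.mem_piFinset] at hm ⊢
  exact ⟨fun i => hm.1 (σ i), (Equiv.sum_comp σ fun i => m i ^ 2).trans hm.2⟩

lemma eventually_theta_const_mul_ne_zero (hq0 : q ≠ 0) (hq : ‖q‖ < 1) {c : ℂ} (hc : c ≠ 0)
    (hu : u ≠ 0) : ∀ᶠ z in 𝓝[≠] u, theta (c * z) q ≠ 0 := by
  have hcu := mul_ne_zero hc hu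
  by_cases h : theta (c * u) q = 0
  · have h1 : HasDerivAt (fun z => theta (c * z) q)
        (deriv (fun x => theta x q) (c * u) * c) u :=
      HasDerivAt.comp (h := fun z => c * z) u (differentiableAt_theta hq hcu).hasDerivAt
        (by simpa using (hasDerivAt_id u).const_mul c)
    simpa [h] using h1.eventually_ne (mul_ne_zero (deriv_theta_ne_zero hq0 hq hcu h) hc)
  · have h1 : ContinuousAt (fun z => theta (c * z) q) u :=
      continuousAt_theta_comp (by fun_prop) hq hcu
    exact nhdsWithin_le_nhds (h1.eventually_ne h)

/-- Triality: for generic fugacities, the residue sum is invariant under permutations of the four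
fugacities. The difference of the two sides, multiplied by `u² θ(u)`, is `q`-periodic in `u`, has
only removable singularities because the permutation permutes the roots, and vanishes at `u = 1`. -/
theorem residueSum_comp_perm (hq0 : q ≠ 0) (hq : ‖q‖ < 1) (ha : ∀ i, a i ≠ 0)
    (h : IsGeneric a q) (σ : Equiv.Perm (Fin 4)) (hu : u ≠ 0) (hu1 : theta u q ≠ 0)
    (hm : ∀ m ∈ roots, theta (mon a m * u) q ≠ 0) :
    residueSum (a ∘ σ) u q = residueSum a u q := by
  have haσ : ∀ i, (a ∘ σ) i ≠ 0 := fun i => ha _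
  have hσ (z : ℂ) (hz : ∀ m ∈ roots, theta (mon a m * z) q ≠ 0) :
      ∀ m ∈ roots, theta (mon (a ∘ σ) m * z) q ≠ 0 := fun m hm => by
    have := hz _ (comp_perm_mem_roots hm σ.symm)
    rwa [← mon_comp_perm _ _ σ, show (m ∘ σ.symm) ∘ σ = m by ext; simp] at this
  set E : ℂ → ℂ := fun u => u ^ 2 * theta u q * (residueSum (a ∘ σ) u q - residueSum a u q) with hE
  have hEd (z : ℂ) (hz0 : z ≠ 0) (hz : ∀ m ∈ roots, theta (mon a m * z) q ≠ 0) :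
      DifferentiableAt ℂ E z :=
    DifferentiableAt.mul (DifferentiableAt.mul (by fun_prop) (differentiableAt_theta hq hz0))
      ((differentiableAt_residueSum hq haσ (h.comp_perm σ) hz0 (hσ z hz)).sub
        (differentiableAt_residueSum hq ha h hz0 hz))
  have hper (z : ℂ) (hz : z ≠ 0) : E (q * z) = E z := by
    simp only [hE, residueSum_q_mul hq0 hq ha hz, residueSum_q_mul hq0 hq haσ hz,
      theta_q_mul hq0 hq hz]
    field_simp
    ring
  have h1 : ∀ m ∈ roots, theta (mon a m * 1) q ≠ 0 := fun m hm => by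
    rw [mul_one]
    simp only [roots, Finset.mem_filter, Fintype.mem_piFinset, Finset.mem_Icc] at hm
    refine h m (fun h0 => ?_) fun i => abs_le.2 ?_
    · simp [h0] at hm
    · have := hm.1 i
      constructor <;> linarith
  have hev (z : ℂ) (hz : z ≠ 0) : ∀ᶠ y in 𝓝[≠] z, DifferentiableAt ℂ E y := by
    have h2 : ∀ᶠ y in 𝓝[≠] z, ∀ m ∈ roots, theta (mon a m * y) q ≠ 0 :=
      (Finset.eventually_all roots).2 fun m _ =>
        eventually_theta_const_mul_ne_zero hq0 hq (mon_ne_zero ha m) hz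
    filter_upwards [h2, nhdsWithin_le_nhds (isOpen_ne.mem_nhds hz)] with y hy hy0
    exact hEd y hy0 hy
  have key := eq_of_periodic_of_removable hq0 hq hper hev ?_ hu one_ne_zero
    (hEd u hu hm).continuousAt (hEd 1 one_ne_zero h1).continuousAt
  · have h3 : E 1 = 0 := by simp [hE, theta_one hq]
    rw [h3, hE] at key
    have h4 : u ^ 2 * theta u q ≠ 0 := by positivity
    exact sub_eq_zero.1 ((mul_eq_zero.1 key).resolve_left h4)
  · intro z hz
    by_cases hz' : ∀ m ∈ roots, theta (mon a m * z) q ≠ 0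
    · refine ⟨0, ?_⟩
      have hc : ContinuousAt (fun y => (y - z) * E y) z :=
        ContinuousAt.mul (by fun_prop) (hEd z hz hz').continuousAt
      simpa using hc.tendsto.mono_left nhdsWithin_le_nhds
    · push Not at hz'
      obtain ⟨m, hmr, hmz⟩ := hz'
      have hm0 := mon_ne_zero ha m
      obtain ⟨k, hk⟩ := (theta_eq_zero_iff hq0 hq (mul_ne_zero hm0 hz)).1 hmz
      have hk' : q ^ (-k) * z = (mon a m)⁻¹ := by
        rw [zpow_neg, ← hk]; field_simp
      refine ⟨-k, ?_⟩
      rw [hk']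
      have hs := tendsto_sub_mul_residueSum hq ha h hmr
      have hs' := tendsto_sub_mul_residueSum hq haσ (h.comp_perm σ) (comp_perm_mem_roots hmr σ)
      rw [mon_comp_perm, rootResidue_comp_perm] at hs'
      have hc : ContinuousAt (fun y => y ^ 2 * theta y q) (mon a m)⁻¹ :=
        ContinuousAt.mul (by fun_prop) (differentiableAt_theta hq (inv_ne_zero hm0)).continuousAt
      have := (hc.tendsto.mono_left nhdsWithin_le_nhds).mul (hs'.sub hs)
      rw [sub_self, mul_zero] at this
      refine this.congr fun y => ?_
      simp only [hE]
      ring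

end ResidueSum

/-! ### The integrand -/

section Integrand

open VectorWeight

variable {a : Fin 4 → ℂ} {v q ξ : ℂ} {j k : VectorWeight}

/-- The integrand, written in terms of the weights of the vector representation. -/
noncomputable def gaugeIntegrand (a : Fin 4 → ℂ) (v q ξ : ℂ) : ℂ :=
  qPoch q q ^ 2 * theta (v ^ 2) q * (theta (v ^ 2 * ξ ^ 2) q * theta (v ^ 2 * (ξ ^ 2)⁻¹) q *
    (theta (ξ ^ 2) q * theta (ξ ^ 2)⁻¹ q)) /
      ∏ k : VectorWeight, theta (v * fug a k * ξ) q * theta (v * fug a k * ξ⁻¹) q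

lemma fug_true (a : Fin 4 → ℂ) (s t : ℤˣ) :
    fug a (true, s, t) = a 0 ^ (s : ℤ) * a 1 ^ (t : ℤ) := by
  simp [fug, mon, coords, Fin.prod_univ_four]

lemma fug_false (a : Fin 4 → ℂ) (s t : ℤˣ) :
    fug a (false, s, t) = a 2 ^ (s : ℤ) * a 3 ^ (t : ℤ) := by
  simp [fug, mon, coords, Fin.prod_univ_four]

lemma prod_units_int {M : Type*} [CommMonoid M] (f : ℤˣ → M) : ∏ s : ℤˣ, f s = f 1 * f (-1) := by
  rw [UnitsInt.univ, Finset.prod_insert (by decide), Finset.prod_singleton]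

lemma integrand_eq_gaugeIntegrand (hq0 : q ≠ 0) (a : Fin 4 → ℂ) (v ξ : ℂ) :
    integrand (a 0) (a 1) (a 2) (a 3) v q ξ = gaugeIntegrand a v q ξ := by
  have h1 : theta (q * ξ ^ 2 / v ^ 2) q = theta (v ^ 2 * (ξ ^ 2)⁻¹) q := by
    rw [← theta_q_div hq0 (v ^ 2 * (ξ ^ 2)⁻¹), ← div_eq_mul_inv, div_div_eq_mul_div]
  have h2 : theta (q * (ξ ^ 2)⁻¹ / v ^ 2) q = theta (v ^ 2 * ξ ^ 2) q := by
    rw [← theta_q_div hq0 (v ^ 2 * ξ ^ 2), mul_comm (v ^ 2), ← div_div, div_eq_mul_inv q]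
  have h3 (x y z : ℂ) : v * x * y * z = v * (x * y) * z := by ring
  have e2 : ξ ^ (2 : ℤ) = ξ ^ 2 := zpow_ofNat ξ 2
  have e3 : ξ ^ (-2 : ℤ) = (ξ ^ 2)⁻¹ := by rw [zpow_neg, e2]
  rw [integrand, indexT2, indexT2, indexV, gaugeIntegrand, Fintype.prod_prod_type,
    Fintype.prod_bool]
  simp only [Fintype.prod_prod_type, fug_true, fug_false, prod_units_int, Units.val_one,
    Units.val_neg, zpow_one, mul_one, mul_neg, theta_q_div hq0, zpow_neg, e2, e3, h1, h2, inv_inv]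
  have h5 (x y : ℂ) : v * ξ⁻¹ * x * y = v * (x * y) * ξ⁻¹ := by ring
  have h6 (x y : ℂ) : v * ξ * x * y = v * (x * y) * ξ := by ring
  simp only [h5, h6, h3]
  simp only [div_eq_mul_inv, mul_inv, one_mul]
  ring

lemma gaugeIntegrand_inv (a : Fin 4 → ℂ) (v q ξ : ℂ) :
    gaugeIntegrand a v q ξ⁻¹ = gaugeIntegrand a v q ξ := by
  rw [gaugeIntegrand, gaugeIntegrand, inv_inv, inv_pow, inv_inv]
  congr 1
  · ring
  · exact Finset.prod_congr rfl fun k _ => mul_comm _ _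

lemma theta_q_sq_mul_mul_theta_div (hq0 : q ≠ 0) (hq : ‖q‖ < 1) {x y : ℂ} (hx : x ≠ 0)
    (hy : y ≠ 0) : theta (q ^ 2 * x) q * theta (y / q ^ 2) q =
      (q ^ 4)⁻¹ * (y / x) ^ 2 * (theta x q * theta y q) := by
  have h1 : theta y q = q * (q ^ 2 / y) ^ 2 * q⁻¹ ^ 2 * theta (y / q ^ 2) q := by
    conv_lhs => rw [show y = q * (q * (y / q ^ 2)) by field_simp]
    rw [theta_q_mul hq0 hq (by positivity), theta_q_mul hq0 hq (by positivity)]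
    field_simp
  rw [h1, show q ^ 2 * x = q * (q * x) by ring, theta_q_mul hq0 hq (by positivity),
    theta_q_mul hq0 hq hx]
  field_simp

/-- The integrand descends to the torus `ℂˣ / q^ℤ`. -/
lemma gaugeIntegrand_q_mul (hq0 : q ≠ 0) (hq : ‖q‖ < 1) (ha : ∀ i, a i ≠ 0) (hv : v ≠ 0)
    (hξ : ξ ≠ 0) : gaugeIntegrand a v q (q * ξ) = gaugeIntegrand a v q ξ := by
  have h1 := theta_q_sq_mul_mul_theta_div hq0 hq (x := v ^ 2 * ξ ^ 2) (y := v ^ 2 * (ξ ^ 2)⁻¹)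
    (by positivity) (by positivity)
  have h2 := theta_q_sq_mul_mul_theta_div hq0 hq (x := ξ ^ 2) (y := (ξ ^ 2)⁻¹)
    (by positivity) (by positivity)
  rw [show q ^ 2 * (v ^ 2 * ξ ^ 2) = v ^ 2 * (q * ξ) ^ 2 by ring,
    show v ^ 2 * (ξ ^ 2)⁻¹ / q ^ 2 = v ^ 2 * ((q * ξ) ^ 2)⁻¹ by field_simp] at h1
  rw [show q ^ 2 * ξ ^ 2 = (q * ξ) ^ 2 by ring,
    show (ξ ^ 2)⁻¹ / q ^ 2 = ((q * ξ) ^ 2)⁻¹ by field_simp] at h2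
  have h3 (k : VectorWeight) : theta (v * fug a k * (q * ξ)) q * theta (v * fug a k * (q * ξ)⁻¹) q =
      (q * ξ ^ 2)⁻¹ * (theta (v * fug a k * ξ) q * theta (v * fug a k * ξ⁻¹) q) := by
    have := fug_ne_zero ha k
    rw [show v * fug a k * ξ⁻¹ = q * (v * fug a k * (q * ξ)⁻¹) by field_simp,
      show v * fug a k * (q * ξ) = q * (v * fug a k * ξ) by ring,
      theta_q_mul hq0 hq (by positivity), theta_q_mul hq0 hq (by positivity)]
    field_simp
  have hc : Finset.card (Finset.univ : Finset VectorWeight) = 8 := rfl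
  rw [gaugeIntegrand, gaugeIntegrand, h1, h2, Finset.prod_congr rfl fun k _ => h3 k,
    Finset.prod_mul_distrib, Finset.prod_const, hc]
  field_simp

/-- The denominator of the integrand is nonzero at `ξ`. -/
def IsOrdinary (a : Fin 4 → ℂ) (v q ξ : ℂ) : Prop :=
  ∀ k : VectorWeight, theta (v * fug a k * ξ) q ≠ 0 ∧ theta (v * fug a k * ξ⁻¹) q ≠ 0

lemma continuousAt_fug (ha : ∀ i, a i ≠ 0) (j : VectorWeight) :
    ContinuousAt (fun a => fug a j) a := by
  unfold fug mon
  exact tendsto_finsetProd _ fun i _ => (continuousAt_apply i a).zpow₀ _ (Or.inl (ha i))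

lemma continuousAt_gaugeIntegrand (hq : ‖q‖ < 1) (ha : ∀ i, a i ≠ 0) (hv : v ≠ 0) (hξ : ξ ≠ 0)
    (h : IsOrdinary a v q ξ) :
    ContinuousAt (fun x : (Fin 4 → ℂ) × ℂ => gaugeIntegrand x.1 v q x.2) (a, ξ) := by
  have hf (k : VectorWeight) : ContinuousAt (fun x : (Fin 4 → ℂ) × ℂ => fug x.1 k) (a, ξ) :=
    ContinuousAt.comp (g := fun a => fug a k) (continuousAt_fug ha k) continuousAt_fst
  have hk := fug_ne_zero ha
  have h2 : ContinuousAt (fun x : (Fin 4 → ℂ) × ℂ => x.2⁻¹) (a, ξ) := continuousAt_snd.inv₀ hξ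
  have h3 : ContinuousAt (fun x : (Fin 4 → ℂ) × ℂ => (x.2 ^ 2)⁻¹) (a, ξ) :=
    (continuousAt_snd.pow 2).inv₀ (pow_ne_zero 2 hξ)
  refine ContinuousAt.div (continuousAt_const.mul (ContinuousAt.mul (ContinuousAt.mul ?_ ?_)
    (ContinuousAt.mul ?_ ?_))) (tendsto_finsetProd _ fun k _ => ContinuousAt.mul ?_ ?_)
    (Finset.prod_ne_zero_iff.2 fun k _ => mul_ne_zero (h k).1 (h k).2)
  · exact continuousAt_theta_comp (by fun_prop) hq (by positivity)
  · exact continuousAt_theta_comp (by fun_prop) hq (by positivity)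
  · exact continuousAt_theta_comp (by fun_prop) hq (by positivity)
  · exact continuousAt_theta_comp (by fun_prop) hq (by positivity)
  · have := hk k
    exact continuousAt_theta_comp ((continuousAt_const.mul (hf k)).mul continuousAt_snd) hq
      (by positivity)
  · have := hk k
    exact continuousAt_theta_comp ((continuousAt_const.mul (hf k)).mul h2) hq (by positivity)

lemma differentiableAt_gaugeIntegrand (hq : ‖q‖ < 1) (ha : ∀ i, a i ≠ 0) (hv : v ≠ 0) (hξ : ξ ≠ 0)
    (h : IsOrdinary a v q ξ) : DifferentiableAt ℂ (gaugeIntegrand a v q) ξ := by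
  have hk := fug_ne_zero ha
  refine DifferentiableAt.div (DifferentiableAt.const_mul (DifferentiableAt.mul
    (DifferentiableAt.mul ?_ ?_) (DifferentiableAt.mul ?_ ?_)) _)
    (DifferentiableAt.fun_finsetProd fun k _ => DifferentiableAt.mul ?_ ?_)
    (Finset.prod_ne_zero_iff.2 fun k _ => mul_ne_zero (h k).1 (h k).2)
  · exact differentiableAt_theta_comp (by fun_prop) hq (by positivity)
  · exact differentiableAt_theta_comp (by fun_prop (disch := positivity)) hq (by positivity)
  · exact differentiableAt_theta_comp (by fun_prop) hq (by positivity)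
  · exact differentiableAt_theta_comp (by fun_prop (disch := positivity)) hq (by positivity)
  · have := hk k
    exact differentiableAt_theta_comp (by fun_prop) hq (by positivity)
  · have := hk k
    exact differentiableAt_theta_comp (by fun_prop (disch := positivity)) hq (by positivity)

lemma eventually_isOrdinary (hq0 : q ≠ 0) (hq : ‖q‖ < 1) (ha : ∀ i, a i ≠ 0) (hv : v ≠ 0)
    (hξ : ξ ≠ 0) : ∀ᶠ z in 𝓝[≠] ξ, z ≠ 0 ∧ IsOrdinary a v q z := by
  have h0 : ∀ᶠ z in 𝓝[≠] ξ, z ≠ 0 := nhdsWithin_le_nhds (isOpen_ne.mem_nhds hξ)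
  refine h0.and (eventually_all.2 fun k => ?_)
  have hk := fug_ne_zero ha k
  filter_upwards [eventually_theta_const_mul_ne_zero hq0 hq (mul_ne_zero hv hk) hξ,
    eventually_theta_const_mul_ne_zero hq0 hq (inv_ne_zero (mul_ne_zero hv hk)) hξ,
    nhdsWithin_le_nhds (isOpen_ne.mem_nhds hξ)] with z h1 h2 (hz : z ≠ 0)
  refine ⟨h1, ?_⟩
  rw [Ne, ← theta_inv_eq_zero_iff hq (by positivity)] at h2
  rwa [show v * fug a k * z⁻¹ = ((v * fug a k)⁻¹ * z)⁻¹ by field_simp]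

/-- At a simple pole `ξ = v a^j`, the residue of the integrand with respect to `dξ / ξ` is
`residueTerm a (v ^ 2) q j`. -/
lemma tendsto_sub_mul_gaugeIntegrand (hq : ‖q‖ < 1) (ha : ∀ i, a i ≠ 0) (hv : v ≠ 0)
    (h1 : ∀ k, theta (v ^ 2 * fug a j * fug a k) q ≠ 0)
    (h2 : ∀ k ≠ j, theta (fug a k / fug a j) q ≠ 0) :
    Tendsto (fun z => (z - v * fug a j) * gaugeIntegrand a v q z) (𝓝[≠] (v * fug a j))
      (𝓝 (v * fug a j * residueTerm a (v ^ 2) q j)) := by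
  have hf := fug_ne_zero ha
  have hj := hf j
  set p := v * fug a j with hp
  have hp0 : p ≠ 0 := by positivity
  have hpp : p * p⁻¹ = 1 := mul_inv_cancel₀ hp0
  set g : ℂ → ℂ := fun ξ => qPoch q q ^ 2 * theta (v ^ 2) q *
    (theta (v ^ 2 * ξ ^ 2) q * theta (v ^ 2 * (ξ ^ 2)⁻¹) q *
    (theta (ξ ^ 2) q * theta (ξ ^ 2)⁻¹ q)) / ((∏ k : VectorWeight, theta (v * fug a k * ξ) q) *
      ∏ k ∈ Finset.univ.erase j, theta (v * fug a k * ξ⁻¹) q) with hg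
  have e1 (k : VectorWeight) : v * fug a k * p = v ^ 2 * fug a j * fug a k := by rw [hp]; ring
  have e2 (k : VectorWeight) : v * fug a k * p⁻¹ = fug a k / fug a j := by rw [hp]; field_simp
  have hcont : ContinuousAt g p := by
    refine ContinuousAt.div (continuousAt_const.mul (ContinuousAt.mul (ContinuousAt.mul ?_ ?_)
      (ContinuousAt.mul ?_ ?_))) (ContinuousAt.mul (tendsto_finsetProd _ fun k _ => ?_)
      (tendsto_finsetProd _ fun k _ => ?_))
      (mul_ne_zero (Finset.prod_ne_zero_iff.2 fun k _ => ?_)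
        (Finset.prod_ne_zero_iff.2 fun k hk => ?_))
    · exact continuousAt_theta_comp (by fun_prop) hq (by positivity)
    · exact continuousAt_theta_comp (by fun_prop (disch := positivity)) hq (by positivity)
    · exact continuousAt_theta_comp (by fun_prop) hq (by positivity)
    · exact continuousAt_theta_comp (by fun_prop (disch := positivity)) hq (by positivity)
    · have := hf k
      exact continuousAt_theta_comp (by fun_prop) hq (by positivity)
    · have := hf k
      exact continuousAt_theta_comp (by fun_prop (disch := positivity)) hq (by positivity)
    · rw [e1]; exact h1 k
    · rw [e2]; exact h2 k (Finset.ne_of_mem_erase hk)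
  have hpole : Tendsto (fun z => (z - p) / theta (p * z⁻¹) q) (𝓝[≠] p)
      (𝓝 (p * (qPoch q q ^ 2)⁻¹)) := by
    have := tendsto_theta_comp_div_sub hq ((hasDerivAt_inv hp0).const_mul p) (by simp [hpp])
      (by simp [hpp, theta_one hq])
    rw [hpp, (hasDerivAt_theta_one hq).deriv] at this
    have hqq := qPoch_self_ne_zero hq
    have h3 := this.inv₀ (by simp [hqq, hp0])
    refine (h3.congr fun z => inv_div _ _).trans_eq ?_
    congr 1
    field_simp
  have hlim := hpole.mul (hcont.tendsto.mono_left nhdsWithin_le_nhds)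
  refine (hlim.congr fun z => ?_).trans_eq ?_
  · rw [gaugeIntegrand, hg, Finset.prod_mul_distrib,
      ← Finset.mul_prod_erase Finset.univ (fun k => theta (v * fug a k * z⁻¹) q)
        (Finset.mem_univ j), ← hp]
    simp only [div_eq_mul_inv, mul_inv]
    ring
  · have hu : (Finset.univ : Finset VectorWeight).erase j = insert j.conj j.others := by
      ext k; simp only [Finset.mem_erase, Finset.mem_univ, and_true, Finset.mem_insert, mem_others]
      have := conj_ne j
      constructor
      · intro h; by_cases hk : k = j.conj <;> simp [h, hk]
      · rintro (rfl | h)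
        exacts [this, h.1]
    have hn : j.conj ∉ j.others := by simp [mem_others]
    have e3 : v ^ 2 * fug a j * fug a j.conj = v ^ 2 := by rw [fug_conj]; field_simp
    have e4 : v ^ 2 * p ^ 2 = (v ^ 2) ^ 2 * fug a j ^ 2 := by rw [hp]; ring
    have e5 : v ^ 2 * (p ^ 2)⁻¹ = fug a j.conj / fug a j := by rw [fug_conj, hp]; field_simp
    have e6 : p ^ 2 = v ^ 2 * fug a j * fug a j := by rw [hp]; ring
    have e7 : v ^ 2 * fug a j ^ 2 = v ^ 2 * fug a j * fug a j := by ring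
    rw [hg, residueTerm, Finset.prod_mul_distrib]
    simp only [e1, e2]
    rw [← Finset.mul_prod_erase Finset.univ (fun k => theta (v ^ 2 * fug a j * fug a k) q)
        (Finset.mem_univ j), hu, Finset.prod_insert hn, Finset.prod_insert hn, e3, e4, e5, e6, e7]
    have n1 := h1 j
    have n2 := h1 j.conj
    rw [e3] at n2
    have n3 := h2 _ (conj_ne j)
    have n4 := qPoch_self_ne_zero hq
    have key (Q A B C D E P R : ℂ) (hQ : Q ≠ 0) (hA : A ≠ 0) (hC : C ≠ 0) (hD : D ≠ 0) :
        p * Q⁻¹ * (Q * A * (B * C * (D * E)) / (D * (A * P) * (C * R))) =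
          p * (B * E / (P * R)) := by
      field_simp
    exact congrArg _ (key _ _ _ _ _ _ _ _ (by positivity) n2 n3 n1)

end Integrand

/-! ### The poles of a given charge -/

section Poles

open VectorWeight

variable {a : Fin 4 → ℂ} {v q c : ℂ} {j k : VectorWeight}

/-- The pole `v a^j` (for `ε = -1`) or `v⁻¹ a^{-j}` (for `ε = 1`) of the integrand. -/
noncomputable def chargedPole (ε : ℤˣ) (v : ℂ) (a : Fin 4 → ℂ) (j : VectorWeight) : ℂ :=
  (v * fug a j) ^ (-(ε : ℤ))

lemma chargedPole_ne_zero (ε : ℤˣ) (ha : ∀ i, a i ≠ 0) (hv : v ≠ 0) (j : VectorWeight) :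
    chargedPole ε v a j ≠ 0 :=
  zpow_ne_zero _ (mul_ne_zero hv (fug_ne_zero ha j))

lemma theta_mul_zpow_eq_zero_iff (ε : ℤˣ) (hq : ‖q‖ < 1) (ha : ∀ i, a i ≠ 0) (hv : v ≠ 0)
    (hc : c ≠ 0) :
    theta (v * fug a k * c ^ (ε : ℤ)) q = 0 ↔ theta (c / chargedPole ε v a k) q = 0 := by
  have hk := fug_ne_zero ha k
  rcases Int.units_eq_one_or ε with rfl | rfl
  · simp only [chargedPole, Units.val_one, zpow_neg, zpow_one, div_inv_eq_mul, mul_comm c]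
  · rw [← theta_inv_eq_zero_iff hq (by positivity), chargedPole]
    simp [div_eq_mul_inv, mul_comm c]

lemma isOrdinary_iff (ε : ℤˣ) (hq : ‖q‖ < 1) (ha : ∀ i, a i ≠ 0) (hv : v ≠ 0) (hc : c ≠ 0) :
    IsOrdinary a v q c ↔ ∀ k, theta (c * chargedPole ε v a k) q ≠ 0 ∧
      theta (c / chargedPole ε v a k) q ≠ 0 := by
  refine forall_congr' fun k => ?_
  have hk := fug_ne_zero ha k
  have h : theta (c * (v * fug a k)⁻¹) q = 0 ↔ theta (v * fug a k * c⁻¹) q = 0 := by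
    rw [← theta_inv_eq_zero_iff hq (by positivity), mul_inv, inv_inv, mul_comm]
  rcases Int.units_eq_one_or ε with rfl | rfl
  · simp only [chargedPole, Units.val_one, zpow_neg, zpow_one, div_inv_eq_mul, Ne, h]
    rw [mul_comm c, and_comm]
  · simp only [chargedPole, Units.val_neg, Units.val_one, neg_neg, zpow_one, Ne, div_eq_mul_inv, h]
    rw [mul_comm c]

lemma theta_chargedPole_mul_eq_zero_iff (ε : ℤˣ) (hq : ‖q‖ < 1) (ha : ∀ i, a i ≠ 0)
    (hv : v ≠ 0) : theta (chargedPole ε v a j * chargedPole ε v a k) q = 0 ↔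
      theta (v ^ 2 * fug a j * fug a k) q = 0 := by
  have hj := fug_ne_zero ha j
  have hk := fug_ne_zero ha k
  have h : v * fug a j * (v * fug a k) = v ^ 2 * fug a j * fug a k := by ring
  rcases Int.units_eq_one_or ε with rfl | rfl
  · rw [chargedPole, chargedPole, ← mul_zpow, h]
    rw [Units.val_one, zpow_neg, zpow_one]
    exact theta_inv_eq_zero_iff hq (by positivity)
  · rw [chargedPole, chargedPole, ← mul_zpow, h]
    simp

lemma theta_chargedPole_div_eq_zero_iff (ε : ℤˣ) (hq : ‖q‖ < 1) (ha : ∀ i, a i ≠ 0)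
    (hv : v ≠ 0) : theta (chargedPole ε v a k / chargedPole ε v a j) q = 0 ↔
      theta (fug a k / fug a j) q = 0 := by
  have hj := fug_ne_zero ha j
  have hk := fug_ne_zero ha k
  have h : v * fug a k / (v * fug a j) = fug a k / fug a j := by field_simp
  rcases Int.units_eq_one_or ε with rfl | rfl
  · rw [chargedPole, chargedPole, ← div_zpow, h]
    rw [Units.val_one, zpow_neg, zpow_one]
    exact theta_inv_eq_zero_iff hq (by positivity)
  · rw [chargedPole, chargedPole, ← div_zpow, h]
    simp

lemma tendsto_inv_punctured (hc : c ≠ 0) : Tendsto (fun z : ℂ => z⁻¹) (𝓝[≠] c⁻¹) (𝓝[≠] c) := by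
  refine tendsto_nhdsWithin_iff.2 ⟨?_, ?_⟩
  · have : ContinuousAt (fun z : ℂ => z⁻¹) c⁻¹ := continuousAt_inv₀ (inv_ne_zero hc)
    simpa using this.tendsto.mono_left nhdsWithin_le_nhds
  · filter_upwards [self_mem_nhdsWithin] with z hz h
    exact hz (by simp [← (show z⁻¹ = c from h)])

lemma tendsto_sub_mul_gaugeIntegrand_div (ε : ℤˣ) (hq0 : q ≠ 0) (hq : ‖q‖ < 1)
    (ha : ∀ i, a i ≠ 0) (hv : v ≠ 0) (h1 : ∀ k, theta (v ^ 2 * fug a j * fug a k) q ≠ 0)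
    (h2 : ∀ k ≠ j, theta (fug a k / fug a j) q ≠ 0) (n : ℤ) :
    Tendsto (fun z => (z - q ^ n * chargedPole ε v a j) * (gaugeIntegrand a v q z / z))
      (𝓝[≠] (q ^ n * chargedPole ε v a j))
      (𝓝 (-((ε : ℤ) : ℂ) * residueTerm a (v ^ 2) q j)) := by
  have hj := fug_ne_zero ha j
  have h := tendsto_sub_mul_gaugeIntegrand hq ha hv h1 h2
  have h0 : Tendsto (fun z => (z - chargedPole ε v a j) * gaugeIntegrand a v q z)
      (𝓝[≠] (chargedPole ε v a j))
      (𝓝 (chargedPole ε v a j * (-((ε : ℤ) : ℂ) * residueTerm a (v ^ 2) q j))) := by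
    rcases Int.units_eq_one_or ε with rfl | rfl
    · simp only [chargedPole, Units.val_one, zpow_neg, zpow_one]
      set p := v * fug a j with hp
      have hp0 : p ≠ 0 := by positivity
      have h3 := h.comp (tendsto_inv_punctured hp0)
      have h4 : Tendsto (fun z : ℂ => -(z / p)) (𝓝[≠] p⁻¹) (𝓝 (-(p⁻¹ / p))) :=
        (ContinuousAt.tendsto (by fun_prop)).mono_left nhdsWithin_le_nhds
      refine ((h4.mul h3).congr' ?_).trans_eq ?_
      · filter_upwards [nhdsWithin_le_nhds (isOpen_ne.mem_nhds (inv_ne_zero hp0))] with z hz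
        simp only [Function.comp_apply, gaugeIntegrand_inv]
        have hz : z ≠ 0 := hz
        field_simp
        ring
      · congr 1
        push_cast
        field_simp
    · simpa [chargedPole] using h
  set p := chargedPole ε v a j
  have hp : p ≠ 0 := chargedPole_ne_zero ε ha hv j
  have hP : q ^ n * p ≠ 0 := mul_ne_zero (zpow_ne_zero _ hq0) hp
  have h3 := tendsto_sub_mul_of_zpow_mul hq0 (E := gaugeIntegrand a v q)
    (fun u hu => gaugeIntegrand_q_mul hq0 hq ha hv hu) (-n) (u := q ^ n * p)
    (ρ := q ^ n * (p * (-((ε : ℤ) : ℂ) * residueTerm a (v ^ 2) q j))) hP (by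
      have e (x : ℂ) : q ^ (-n) * (q ^ n * x) = x := by
        rw [zpow_neg, inv_mul_cancel_left₀ (zpow_ne_zero _ hq0)]
      rw [e, e]
      exact h0)
  have h4 := h3.div ((continuousAt_id (x := q ^ n * p)).tendsto.mono_left nhdsWithin_le_nhds) hP
  refine (h4.congr fun z => ?_).trans_eq ?_
  · simp [mul_div_assoc]
  · congr 1
    simp only [id]
    field_simp

/-- If poles of opposite charges collide at `c`, then `c²` is a power of `q`, and the double zero of
`θ(ξ²) θ(ξ⁻²)` makes the integrand bounded near `c`. -/
lemma tendsto_sub_mul_gaugeIntegrand_of_collision (hq0 : q ≠ 0) (hq : ‖q‖ < 1)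
    (ha : ∀ i, a i ≠ 0) (hv : v ≠ 0) (hc : c ≠ 0)
    (h1 : theta (v * fug a j * c) q = 0) (h2 : theta (v * fug a j * c⁻¹) q = 0)
    (h3 : ∀ k ≠ j, theta (v * fug a k * c) q ≠ 0 ∧ theta (v * fug a k * c⁻¹) q ≠ 0) :
    Tendsto (fun z => (z - c) * gaugeIntegrand a v q z) (𝓝[≠] c) (𝓝 0) := by
  have hf := fug_ne_zero ha
  have hj := hf j
  have hc2 : theta (c ^ 2) q = 0 := by
    have e : v * fug a j * c = (v * fug a j * c⁻¹) * c ^ 2 := by field_simp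
    rw [e] at h1
    exact (theta_mul_eq_zero_iff hq0 hq (by positivity) (by positivity) h2).1 h1
  have hc2' : theta (c ^ 2)⁻¹ q = 0 := (theta_inv_eq_zero_iff hq (by positivity)).2 hc2
  have hsq : HasDerivAt (fun z : ℂ => z ^ 2) (2 * c) c := by simpa using hasDerivAt_pow 2 c
  have s1 := tendsto_theta_comp_div_sub hq hsq (by positivity) hc2
  have s2 := tendsto_theta_comp_div_sub hq (hsq.fun_inv (by positivity)) (by positivity) hc2'
  have s3 := tendsto_theta_comp_div_sub hq ((hasDerivAt_id c).const_mul (v * fug a j))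
    (by simp only [id]; positivity) h1
  have s4 := tendsto_theta_comp_div_sub hq ((hasDerivAt_inv hc).const_mul (v * fug a j))
    (by positivity) h2
  have n3 := deriv_theta_ne_zero hq0 hq (by positivity) h1
  have n4 := deriv_theta_ne_zero hq0 hq (by positivity) h2
  set g : ℂ → ℂ := fun ξ => qPoch q q ^ 2 * theta (v ^ 2) q *
    (theta (v ^ 2 * ξ ^ 2) q * theta (v ^ 2 * (ξ ^ 2)⁻¹) q) /
      ∏ k ∈ Finset.univ.erase j, theta (v * fug a k * ξ) q * theta (v * fug a k * ξ⁻¹) q with hg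
  have hcont : ContinuousAt (fun z => (z - c) * g z) c := by
    refine ContinuousAt.mul (by fun_prop) (ContinuousAt.div (continuousAt_const.mul
      (ContinuousAt.mul ?_ ?_)) (tendsto_finsetProd _ fun k _ => ContinuousAt.mul ?_ ?_)
      (Finset.prod_ne_zero_iff.2 fun k hk => ?_))
    · exact continuousAt_theta_comp (by fun_prop) hq (by positivity)
    · exact continuousAt_theta_comp (by fun_prop (disch := positivity)) hq (by positivity)
    · have := hf k
      exact continuousAt_theta_comp (by fun_prop) hq (by positivity)
    · have := hf k
      exact continuousAt_theta_comp (by fun_prop (disch := positivity)) hq (by positivity)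
    · have := h3 k (Finset.ne_of_mem_erase hk)
      exact mul_ne_zero this.1 this.2
  have hlim := (hcont.tendsto.mono_left nhdsWithin_le_nhds).mul ((s1.mul s2).div (s3.mul s4)
    (mul_ne_zero (mul_ne_zero n3 (by simpa using ⟨hv, hj⟩))
      (mul_ne_zero n4 (by simp [hv, hj, hc]))))
  simp only [sub_self, zero_mul] at hlim
  refine hlim.congr' ?_
  filter_upwards [self_mem_nhdsWithin] with z hz
  have hz : z - c ≠ 0 := sub_ne_zero.2 hz
  rw [gaugeIntegrand, hg, ← Finset.mul_prod_erase Finset.univ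
    (fun k => theta (v * fug a k * z) q * theta (v * fug a k * z⁻¹) q) (Finset.mem_univ j)]
  simp only [id]
  have key (d A B C D E P Q : ℂ) (hd : d ≠ 0) :
      d * (Q * E / P) * (A / d * (B / d) / (C / d * (D / d))) =
        d * (Q * (E * (A * B)) / (C * D * P)) := by
    field_simp
  exact key _ _ _ _ _ _ _ _ hz

end Poles

/-! ### Continuity of the index -/

section Continuity

open VectorWeight Metric

variable {a : Fin 4 → ℂ} {v q c : ℂ} {j k : VectorWeight}

lemma tendsto_circleIntegral_of_continuousAt {X : Type*} [TopologicalSpace X] {f : X → ℂ → ℂ}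
    {x₀ : X} {L : Filter X} [L.IsCountablyGenerated] (hL : L ≤ 𝓝 x₀) {r : ℝ} (hr : 0 ≤ r)
    (h : ∀ z ∈ sphere c r, ContinuousAt (Function.uncurry f) (x₀, z))
    (hf : ∀ᶠ x in L, ContinuousOn (f x) (sphere c r)) :
    Tendsto (fun x => ∮ z in C(c, r), f x z) L (𝓝 (∮ z in C(c, r), f x₀ z)) := by
  refine TendstoUniformlyOn.tendsto_circleIntegral_of_continuousOn hr hf ?_
  rw [← tendstoLocallyUniformlyOn_iff_tendstoUniformlyOn_of_compact (isCompact_sphere c r),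
    Metric.tendstoLocallyUniformlyOn_iff]
  intro e he z hz
  have h1 := (Metric.tendsto_nhds.1 (h z hz)) (e / 2) (half_pos he)
  rw [nhds_prod_eq] at h1
  obtain ⟨P, hP, Q, hQ, hPQ⟩ := eventually_prod_iff.1 h1
  refine ⟨{y | Q y}, nhdsWithin_le_nhds hQ, ?_⟩
  filter_upwards [hL hP] with x hx y hy
  have h2 := hPQ hx hy
  have h3 := hPQ hP.self_of_nhds hy
  simp only [Function.uncurry] at h2 h3
  calc dist (f x₀ y) (f x y) ≤ dist (f x₀ y) (f x₀ z) + dist (f x y) (f x₀ z) :=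
        dist_triangle_right _ _ _
    _ < e := by linarith

lemma continuousAt_chargedPole (ε : ℤˣ) (ha : ∀ i, a i ≠ 0) (hv : v ≠ 0) (j : VectorWeight) :
    ContinuousAt (fun a => chargedPole ε v a j) a :=
  (continuousAt_const.mul (continuousAt_fug ha j)).zpow₀ _
    (Or.inl (mul_ne_zero hv (fug_ne_zero ha j)))

lemma eventually_theta_eq_zero_imp_eq_one (hq : ‖q‖ < 1) :
    ∀ᶠ z in 𝓝 (1 : ℂ), theta z q = 0 → z = 1 := by
  have := (hasDerivAt_theta_one hq).eventually_ne (c := 0)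
    (by simpa using qPoch_self_ne_zero hq)
  rw [eventually_nhdsWithin_iff] at this
  filter_upwards [this] with z hz h
  by_contra h1
  exact hz h1 h

/-- Local description of the singularities of the integrand near a point `c` at which no pole of the
opposite charge sits, uniformly for nearby fugacities. -/
lemma eventually_isOrdinary_or_eq (ε : ℤˣ) (hq0 : q ≠ 0) (hq : ‖q‖ < 1) (ha : ∀ i, a i ≠ 0)
    (hv : v ≠ 0) (hc : c ≠ 0) (n : VectorWeight → ℤ) (s : Finset VectorWeight)
    (hs : ∀ j ∈ s, q ^ n j * chargedPole ε v a j = c)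
    (hs' : ∀ j ∉ s, theta (c / chargedPole ε v a j) q ≠ 0)
    (hmix : ∀ j, theta (c * chargedPole ε v a j) q ≠ 0) :
    ∀ᶠ x in 𝓝 (a, c), (∀ i, x.1 i ≠ 0) ∧ x.2 ≠ 0 ∧
      (IsOrdinary x.1 v q x.2 ∨ ∃ j ∈ s, x.2 = q ^ n j * chargedPole ε v x.1 j) := by
  have hp0 := chargedPole_ne_zero ε ha hv
  have hp (j : VectorWeight) :
      ContinuousAt (fun x : (Fin 4 → ℂ) × ℂ => chargedPole ε v x.1 j) (a, c) :=
    ContinuousAt.comp (g := fun a => chargedPole ε v a j) (continuousAt_chargedPole ε ha hv j)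
      continuousAt_fst
  have e1 : ∀ᶠ x : (Fin 4 → ℂ) × ℂ in 𝓝 (a, c), ∀ i, x.1 i ≠ 0 := by
    refine eventually_all.2 fun i => ?_
    have : ContinuousAt (fun x : (Fin 4 → ℂ) × ℂ => x.1 i) (a, c) := by fun_prop
    exact this.eventually_ne (ha i)
  have e2 : ∀ᶠ x : (Fin 4 → ℂ) × ℂ in 𝓝 (a, c), x.2 ≠ 0 := continuousAt_snd.eventually_ne hc
  have e3 : ∀ᶠ x : (Fin 4 → ℂ) × ℂ in 𝓝 (a, c), ∀ j,
      theta (x.2 * chargedPole ε v x.1 j) q ≠ 0 := eventually_all.2 fun j =>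
    (continuousAt_theta_comp (continuousAt_snd.mul (hp j)) hq
      (mul_ne_zero hc (hp0 j))).eventually_ne (hmix j)
  have e4 : ∀ᶠ x : (Fin 4 → ℂ) × ℂ in 𝓝 (a, c), ∀ j,
      theta (x.2 / chargedPole ε v x.1 j) q = 0 →
        j ∈ s ∧ x.2 = q ^ n j * chargedPole ε v x.1 j := by
    refine eventually_all.2 fun j => ?_
    have hd : ContinuousAt (fun x : (Fin 4 → ℂ) × ℂ => x.2 / chargedPole ε v x.1 j) (a, c) :=
      continuousAt_snd.div (hp j) (hp0 j)
    by_cases hj : j ∈ s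
    · have hqn := zpow_ne_zero (n j) hq0
      have hd1 : Tendsto (fun x : (Fin 4 → ℂ) × ℂ => (q ^ n j)⁻¹ * (x.2 / chargedPole ε v x.1 j))
          (𝓝 (a, c)) (𝓝 1) := by
        have h1 : (q ^ n j)⁻¹ * (c / chargedPole ε v a j) = 1 := by
          have := hp0 j
          rw [← hs j hj]
          field_simp
        exact (continuousAt_const.mul hd).tendsto.trans_eq (congrArg 𝓝 h1)
      filter_upwards [hd1.eventually (eventually_theta_eq_zero_imp_eq_one hq), e1, e2]
        with x hx hx1 hx2 h0
      have hpx := chargedPole_ne_zero ε hx1 hv j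
      have h1 := hx (by
        rw [← zpow_neg]
        exact (theta_zpow_mul_eq_zero_iff hq0 hq (div_ne_zero hx2 hpx) _).2 h0)
      refine ⟨hj, ?_⟩
      field_simp at h1
      exact h1
    · filter_upwards
        [(continuousAt_theta_comp hd hq (div_ne_zero hc (hp0 j))).eventually_ne (hs' j hj)]
        with x hx h0 using absurd h0 hx
  filter_upwards [e1, e2, e3, e4] with x h1 h2 h3 h4
  refine ⟨h1, h2, ?_⟩
  by_cases h : ∃ j, theta (x.2 / chargedPole ε v x.1 j) q = 0
  · obtain ⟨j, hj⟩ := h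
    exact Or.inr ⟨j, h4 j hj⟩
  · push Not at h
    exact Or.inl ((isOrdinary_iff ε hq h1 hv h2).2 fun k => ⟨h3 k, h k⟩)

/-- When several poles of the same charge merge at `c` as the fugacities tend to `a`, the sum of
their residues tends to the residue of the limiting integrand: both are integrals over a fixed small
circle around `c`. -/
lemma tendsto_sum_residueTerm (ε : ℤˣ) (hq0 : q ≠ 0) (hq : ‖q‖ < 1) (ha : ∀ i, a i ≠ 0)
    (hv : v ≠ 0) (hc : c ≠ 0) (n : VectorWeight → ℤ) (s : Finset VectorWeight)
    (hs : ∀ j ∈ s, q ^ n j * chargedPole ε v a j = c)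
    (hs' : ∀ j ∉ s, theta (c / chargedPole ε v a j) q ≠ 0)
    (hmix : ∀ j, theta (c * chargedPole ε v a j) q ≠ 0)
    {L : Filter (Fin 4 → ℂ)} [L.IsCountablyGenerated] (hL : L ≤ 𝓝 a)
    (hgen : ∀ᶠ b in L, IsGeneric b q ∧ ∀ j k, theta (v ^ 2 * fug b j * fug b k) q ≠ 0) :
    Tendsto (fun b => ∑ j ∈ s, residueTerm b (v ^ 2) q j) L
      (𝓝 (-((ε : ℤ) : ℂ) * residue (fun ζ => gaugeIntegrand a v q ζ / ζ) c)) := by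
  have hloc := eventually_isOrdinary_or_eq ε hq0 hq ha hv hc n s hs hs' hmix
  rw [nhds_prod_eq] at hloc
  obtain ⟨P, hP, Q, hQ, hPQ⟩ := eventually_prod_iff.1 hloc
  obtain ⟨R, hR, hRQ⟩ := Metric.eventually_nhds_iff_ball.1 hQ
  have hr := half_pos hR
  have hrR := half_lt_self hR
  have hdiff (b : Fin 4 → ℂ) (hb : P b) (z : ℂ) (hz : z ∈ ball c R)
      (hzs : ∀ j ∈ s, z ≠ q ^ n j * chargedPole ε v b j) :
      DifferentiableAt ℂ (fun ζ => gaugeIntegrand b v q ζ / ζ) z := by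
    obtain ⟨h1, h2, h3⟩ := hPQ hb (hRQ z hz)
    rcases h3 with h3 | ⟨j, hj, h3⟩
    · exact (differentiableAt_gaugeIntegrand hq h1 hv h2 h3).div differentiableAt_id h2
    · exact absurd h3 (hzs j hj)
  have hsph (z : ℂ) (hz : z ∈ sphere c (R / 2)) : z ∈ ball c R := by
    rw [mem_sphere] at hz
    rw [mem_ball, hz]
    exact hrR
  have hin : ∀ᶠ b in 𝓝 a, ∀ j ∈ s, q ^ n j * chargedPole ε v b j ∈ ball c (R / 2) := by
    refine (Finset.eventually_all s).2 fun j hj => ?_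
    have h1 : Tendsto (fun b => q ^ n j * chargedPole ε v b j) (𝓝 a) (𝓝 c) := by
      have := (continuousAt_const (y := q ^ n j)).mul (continuousAt_chargedPole ε ha hv j)
      rw [← hs j hj]
      exact this.tendsto
    exact h1.eventually (ball_mem_nhds c hr)
  have hns (b : Fin 4 → ℂ) (hb : ∀ j ∈ s, q ^ n j * chargedPole ε v b j ∈ ball c (R / 2))
      (z : ℂ) (hz : z ∈ sphere c (R / 2)) : ∀ j ∈ s, z ≠ q ^ n j * chargedPole ε v b j := by
    rintro j hj rfl
    exact (mem_ball.1 (hb j hj)).ne (mem_sphere.1 hz)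
  have hPa : P a := hP.self_of_nhds
  have hres := residue_eq_circleIntegral hr hrR fun z hz hzc =>
    hdiff a hPa z hz fun j hj => by rw [hs j hj]; exact hzc
  have hlim : Tendsto (fun b => ∮ z in C(c, R / 2), gaugeIntegrand b v q z / z) L
      (𝓝 (∮ z in C(c, R / 2), gaugeIntegrand a v q z / z)) := by
    refine tendsto_circleIntegral_of_continuousAt (f := fun b z => gaugeIntegrand b v q z / z)
      hL hr.le (fun z hz => ?_) ?_
    · obtain ⟨h1, h2, h3⟩ := hPQ hPa (hRQ z (hsph z hz))
      rcases h3 with h3 | ⟨j, hj, h3⟩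
      · exact (continuousAt_gaugeIntegrand hq h1 hv h2 h3).div continuousAt_snd h2
      · exact absurd h3 (hns a hin.self_of_nhds z hz j hj)
    · filter_upwards [hL hP, hL hin] with b hb1 hb2 z hz
      exact (hdiff b hb1 z (hsph z hz) (hns b hb2 z hz)).continuousAt.continuousWithinAt
  have hε : ((ε : ℤ) : ℂ) * ((ε : ℤ) : ℂ) = 1 := by
    rw [← Int.cast_mul, ← Units.val_mul, Int.units_mul_self, Units.val_one, Int.cast_one]
  rw [hres]
  refine ((hlim.const_mul (2 * (Real.pi : ℂ) * Complex.I)⁻¹).const_mul (-((ε : ℤ) : ℂ))).congr' ?_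
  filter_upwards [hL hP, hL hin, hgen] with b hb1 hb2 ⟨hb3, hb4⟩
  have hb0 : ∀ i, b i ≠ 0 := (hPQ hb1 (hRQ c (mem_ball_self hR))).1
  have hinj : Set.InjOn (fun j => q ^ n j * chargedPole ε v b j) s := by
    intro j _ k _ hjk
    by_contra hne
    have hpj := chargedPole_ne_zero ε hb0 hv j
    have h1 : chargedPole ε v b k / chargedPole ε v b j = q ^ (n j - n k) := by
      have hqk := zpow_ne_zero (n k) hq0
      have hjk' : q ^ n j * chargedPole ε v b j = q ^ n k * chargedPole ε v b k := hjk
      rw [zpow_sub₀ hq0]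
      field_simp
      linear_combination -hjk'
    have h2 := (theta_eq_zero_iff hq0 hq (div_ne_zero (chargedPole_ne_zero ε hb0 hv k) hpj)).2
      ⟨_, h1⟩
    rw [theta_chargedPole_div_eq_zero_iff ε hq hb0 hv] at h2
    exact theta_div_fug_ne_zero hb0 hb3 (Ne.symm hne) h2
  have hT (j : VectorWeight) := tendsto_sub_mul_gaugeIntegrand_div ε hq0 hq hb0 hv (hb4 j)
    (fun k hk => theta_div_fug_ne_zero hb0 hb3 hk) (n j)
  classical
  rw [circleIntegral_eq_sum_of_simple_poles hr hrR
    (s.image fun j => q ^ n j * chargedPole ε v b j)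
    (fun p hp => by
      obtain ⟨j, hj, rfl⟩ := Finset.mem_image.1 hp
      exact hb2 j hj) (fun z hz hzs => hdiff b hb1 z hz fun j hj h0 => hzs
      (Finset.mem_image.2 ⟨j, hj, h0.symm⟩))
    (fun p => limUnder (𝓝[≠] p) fun z => (z - p) * (gaugeIntegrand b v q z / z))
    (fun p hp => by
      obtain ⟨j, _, rfl⟩ := Finset.mem_image.1 hp
      rw [(hT j).limUnder_eq]
      exact hT j), Finset.sum_image hinj, Finset.sum_congr rfl fun j _ => (hT j).limUnder_eq,
    inv_mul_cancel_left₀ Complex.two_pi_I_ne_zero, ← Finset.mul_sum, ← mul_assoc, neg_mul_neg, hε,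
    one_mul]

/-- A pole at which poles of opposite charges collide does not contribute in the limit, and it does
not contribute to the index. -/
lemma tendsto_residueTerm_of_collision (ε : ℤˣ) (hq0 : q ≠ 0) (hq : ‖q‖ < 1)
    (ha : ∀ i, a i ≠ 0) (hv : v ≠ 0) (hc : c ≠ 0)
    (hreg : ∀ j k, k ≠ j → theta (v ^ 2 * fug a j * fug a k) q ≠ 0)
    (h1 : theta (c * chargedPole ε v a j) q = 0) (h2 : theta (c / chargedPole ε v a j) q = 0) :
    Tendsto (fun b => residueTerm b (v ^ 2) q j) (𝓝 a) (𝓝 0) ∧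
      residue (fun ζ => gaugeIntegrand a v q ζ / ζ) c = 0 := by
  have hp0 := chargedPole_ne_zero ε ha hv
  have hf := fug_ne_zero ha
  have hj := hf j
  have hjj : theta (v ^ 2 * fug a j * fug a j) q = 0 := by
    have e : c * chargedPole ε v a j = (c / chargedPole ε v a j) *
        (chargedPole ε v a j * chargedPole ε v a j) := by
      have := hp0 j
      field_simp
    rw [e, theta_mul_eq_zero_iff hq0 hq (mul_ne_zero (hp0 j) (hp0 j)) (div_ne_zero hc (hp0 j)) h2,
      theta_chargedPole_mul_eq_zero_iff ε hq ha hv] at h1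
    exact h1
  have hdiv (k : VectorWeight) (hk : k ≠ j) : theta (fug a k / fug a j) q ≠ 0 := fun h0 => by
    refine hreg j k hk ?_
    have hk0 := hf k
    rw [show v ^ 2 * fug a j * fug a k = v ^ 2 * fug a j * fug a j * (fug a k / fug a j) by
      field_simp]
    exact (theta_mul_eq_zero_iff hq0 hq (by positivity) (by positivity) hjj).2 h0
  constructor
  · have hcont : ContinuousAt (fun b => residueTerm b (v ^ 2) q j) a := by
      have hfc := fun k => continuousAt_fug ha k
      refine ContinuousAt.div (ContinuousAt.mul ?_ ?_) (tendsto_finsetProd _ fun k _ =>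
        ContinuousAt.mul ?_ ?_) (Finset.prod_ne_zero_iff.2 fun k hk => mul_ne_zero
          (hreg j k ((mem_others _ _).1 hk).1) (hdiv k ((mem_others _ _).1 hk).1))
      · exact continuousAt_theta_comp (continuousAt_const.mul ((hfc j).pow 2)) hq (by positivity)
      · exact continuousAt_theta_comp ((continuousAt_const.mul ((hfc j).pow 2)).inv₀
          (mul_ne_zero (pow_ne_zero 2 hv) (pow_ne_zero 2 hj))) hq (by positivity)
      · have := hf k
        exact continuousAt_theta_comp ((continuousAt_const.mul (hfc j)).mul (hfc k)) hq
          (by positivity)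
      · have := hf k
        exact continuousAt_theta_comp ((hfc k).div (hfc j) (by positivity)) hq (by positivity)
    have h0 : residueTerm a (v ^ 2) q j = 0 := by
      have : theta (v ^ 2 * fug a j ^ 2)⁻¹ q = 0 := by
        rw [theta_inv_eq_zero_iff hq (by positivity), ← hjj]
        congr 1; ring
      rw [residueTerm, this]
      simp
    exact h0 ▸ hcont.tendsto
  · have hord : theta (v * fug a j * c) q = 0 ∧ theta (v * fug a j * c⁻¹) q = 0 := by
      have e1 := theta_mul_zpow_eq_zero_iff (k := j) ε hq ha hv hc
      have e2 := theta_mul_zpow_eq_zero_iff (k := j) ε hq ha hv (inv_ne_zero hc)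
      have e3 : theta (c⁻¹ / chargedPole ε v a j) q = 0 := by
        rwa [← theta_inv_eq_zero_iff hq (div_ne_zero (inv_ne_zero hc) (hp0 j)), inv_div,
          div_inv_eq_mul, mul_comm]
      rcases Int.units_eq_one_or ε with rfl | rfl
      · simpa using And.intro (e1.2 h2) (e2.2 e3)
      · simpa using And.intro (e2.2 e3) (e1.2 h2)
    have hc' := tendsto_sub_mul_gaugeIntegrand_of_collision hq0 hq ha hv hc hord.1 hord.2
      fun k hk => by
        have hk0 := hf k
        refine ⟨fun h0 => hdiv k hk ?_, fun h0 => hdiv k hk ?_⟩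
        · rw [show v * fug a k * c = v * fug a j * c * (fug a k / fug a j) by field_simp] at h0
          exact (theta_mul_eq_zero_iff hq0 hq (by positivity) (by positivity) hord.1).1 h0
        · rw [show v * fug a k * c⁻¹ = v * fug a j * c⁻¹ * (fug a k / fug a j) by field_simp] at h0
          exact (theta_mul_eq_zero_iff hq0 hq (by positivity) (by positivity) hord.2).1 h0
    refine residue_eq_of_tendsto ?_ ?_
    · filter_upwards [eventually_isOrdinary hq0 hq ha hv hc] with z ⟨hz, hz'⟩
      exact (differentiableAt_gaugeIntegrand hq ha hv hz hz').div differentiableAt_id hz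
    · have := hc'.div (continuousAt_id.tendsto.mono_left nhdsWithin_le_nhds) hc
      refine (this.congr fun z => ?_).trans_eq (by simp)
      simp [mul_div_assoc]

/-- The index is the limit of the residue sum along generic fugacities. -/
theorem tendsto_residueSum (ε : ℤˣ) (hq0 : q ≠ 0) (hq : ‖q‖ < 1) (ha : ∀ i, a i ≠ 0) (hv : v ≠ 0)
    (hreg : ∀ j k, k ≠ j → theta (v ^ 2 * fug a j * fug a k) q ≠ 0)
    {L : Filter (Fin 4 → ℂ)} [L.IsCountablyGenerated] (hL : L ≤ 𝓝 a)
    (hgen : ∀ᶠ b in L, IsGeneric b q ∧ ∀ j k, theta (v ^ 2 * fug b j * fug b k) q ≠ 0) :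
    Tendsto (fun b => residueSum b (v ^ 2) q) L
      (𝓝 (2 * index ε (a 0) (a 1) (a 2) (a 3) v q)) := by
  classical
  have hp0 := chargedPole_ne_zero ε ha hv
  choose n hn1 hn2 using fun j => exists_zpow_mul_mem_annulus hq0 hq (hp0 j)
  set P : VectorWeight → ℂ := fun j => q ^ n j * chargedPole ε v a j with hP
  have hP0 (j : VectorWeight) : P j ≠ 0 := mul_ne_zero (zpow_ne_zero _ hq0) (hp0 j)
  have hPdiv (j : VectorWeight) : P j / chargedPole ε v a j = q ^ n j := by
    have := hp0 j
    simp only [hP]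
    field_simp
  have hPz (j : VectorWeight) : theta (P j / chargedPole ε v a j) q = 0 :=
    (theta_eq_zero_iff hq0 hq (div_ne_zero (hP0 j) (hp0 j))).2 ⟨_, hPdiv j⟩
  have huniq (c : ℂ) (hc1 : ‖q‖ < ‖c‖) (hc2 : ‖c‖ ≤ 1) (j : VectorWeight)
      (h : theta (c / chargedPole ε v a j) q = 0) : P j = c := by
    have hc : c ≠ 0 := norm_pos_iff.1 ((norm_nonneg q).trans_lt hc1)
    obtain ⟨m, hm⟩ := (theta_eq_zero_iff hq0 hq (div_ne_zero hc (hp0 j))).1 h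
    have e : P j = q ^ (n j - m) * c := by
      have := hp0 j
      rw [zpow_sub₀ hq0, ← hm]
      simp only [hP]
      field_simp
    rw [e]
    refine eq_of_zpow_mul_mem_annulus hq0 hq hc1 hc2 ?_ ?_
    · rw [← e]; exact hn1 j
    · rw [← e]; exact hn2 j
  have hset : chargedPoles ε (a 0) (a 1) (a 2) (a 3) v q = ↑(Finset.univ.image P) := by
    have hor (ξ : ℂ) :
        ((∃ s t : ℤˣ, theta (v * a 0 ^ (s : ℤ) * a 1 ^ (t : ℤ) * ξ ^ (ε : ℤ)) q = 0) ∨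
        (∃ s t : ℤˣ, theta (v * a 2 ^ (s : ℤ) * a 3 ^ (t : ℤ) * ξ ^ (ε : ℤ)) q = 0)) ↔
        ∃ j, theta (v * fug a j * ξ ^ (ε : ℤ)) q = 0 := by
      simp only [Prod.exists, Bool.exists_bool, fug_true, fug_false, mul_assoc]
      exact or_comm
    ext ξ
    simp only [chargedPoles, Set.mem_ofPred_eq, hor, Finset.coe_image, Finset.coe_univ,
      Set.image_univ, Set.mem_range]
    constructor
    · rintro ⟨h1, h2, j, hj⟩
      have hξ : ξ ≠ 0 := norm_pos_iff.1 ((norm_nonneg q).trans_lt h1)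
      exact ⟨j, huniq ξ h1 h2 j ((theta_mul_zpow_eq_zero_iff ε hq ha hv hξ).1 hj)⟩
    · rintro ⟨j, rfl⟩
      exact ⟨hn1 j, hn2 j, j, (theta_mul_zpow_eq_zero_iff ε hq ha hv (hP0 j)).2 (hPz j)⟩
  have hindex : 2 * index ε (a 0) (a 1) (a 2) (a 3) v q = ∑ c ∈ Finset.univ.image P,
      -((ε : ℤ) : ℂ) * residue (fun ζ => gaugeIntegrand a v q ζ / ζ) c := by
    rw [index, hset, finsum_mem_coe_finset, ← Finset.mul_sum]
    simp only [integrand_eq_gaugeIntegrand hq0]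
    ring
  have hfib (b : Fin 4 → ℂ) : residueSum b (v ^ 2) q = ∑ c ∈ Finset.univ.image P,
      ∑ j ∈ Finset.univ.filter (P · = c), residueTerm b (v ^ 2) q j :=
    (Finset.sum_fiberwise_of_maps_to (fun j _ => Finset.mem_image_of_mem P (Finset.mem_univ j))
      _).symm
  rw [hindex]
  simp only [hfib]
  refine tendsto_finsetSum _ fun c hc => ?_
  obtain ⟨j, -, rfl⟩ := Finset.mem_image.1 hc
  by_cases hmix : ∀ k, theta (P j * chargedPole ε v a k) q ≠ 0
  · refine tendsto_sum_residueTerm ε hq0 hq ha hv (hP0 j) n _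
      (fun k hk => (Finset.mem_filter.1 hk).2) (fun k hk h0 => hk ?_) hmix hL hgen
    exact Finset.mem_filter.2 ⟨Finset.mem_univ k, huniq _ (hn1 j) (hn2 j) k h0⟩
  · push Not at hmix
    obtain ⟨k, hk⟩ := hmix
    -- A pole of the opposite charge at the same point can only be the one of opposite weight.
    have hcoll (i : VectorWeight) (hi : theta (P j / chargedPole ε v a i) q = 0) : k = i := by
      by_contra hne
      refine hreg i k hne ((theta_chargedPole_mul_eq_zero_iff ε hq ha hv).1 ?_)
      rw [show P j * chargedPole ε v a k = (P j / chargedPole ε v a i) *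
        (chargedPole ε v a i * chargedPole ε v a k) by
          have := hp0 i
          field_simp] at hk
      exact (theta_mul_eq_zero_iff hq0 hq (mul_ne_zero (hp0 i) (hp0 k))
        (div_ne_zero (hP0 j) (hp0 i)) hi).1 hk
    obtain rfl := hcoll j (hPz j)
    have hfilter : Finset.univ.filter (P · = P k) = {k} := by
      ext i
      simp only [Finset.mem_filter, Finset.mem_univ, true_and, Finset.mem_singleton]
      exact ⟨fun h => (hcoll i (h ▸ hPz i)).symm, fun h => h ▸ rfl⟩
    obtain ⟨h1, h2⟩ := tendsto_residueTerm_of_collision ε hq0 hq ha hv (hP0 k) hreg hk (hPz k)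
    rw [h2, mul_zero, hfilter]
    simpa using h1.mono_left hL

end Continuity

/-! ### Generic deformations -/

section Deformation

open VectorWeight

variable {a : Fin 4 → ℂ} {v q : ℂ}

lemma roots_cases : ∀ m ∈ roots, (∃ (i : Fin 4) (s : ℤˣ), m = Pi.single i (2 * (s : ℤ))) ∨
    ∃ s : Fin 4 → ℤˣ, m = fun i => (s i : ℤ) := by
  decide +kernel

lemma IsRegular.theta_mon_ne_zero (h : IsRegular a v q) {m : Fin 4 → ℤ} (hm : m ∈ roots) :
    theta (mon a m * v ^ 2) q ≠ 0 := by
  rw [mul_comm]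
  rcases roots_cases m hm with ⟨i, s, rfl⟩ | ⟨s, rfl⟩
  · have e : mon a (Pi.single i (2 * (s : ℤ))) = a i ^ (2 * (s : ℤ)) := by
      rw [mon, Finset.prod_eq_single i (fun j _ hj => by simp [hj]) (by simp)]
      simp
    rw [e]
    exact h.triplet i s
  · exact h.doublets s

lemma theta_sq_mul_fug_mul_fug_ne_zero (ha : ∀ i, a i ≠ 0) (hv : theta (v ^ 2) q ≠ 0)
    (hm : ∀ m ∈ roots, theta (mon a m * v ^ 2) q ≠ 0) (j k : VectorWeight) (hkj : k ≠ j) :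
    theta (v ^ 2 * fug a j * fug a k) q ≠ 0 := by
  by_cases hk : k = j.conj
  · have := fug_ne_zero ha j
    rw [hk, fug_conj, mul_inv_cancel_right₀ this]
    exact hv
  · have := hm _ ((mem_roots_iff_exists _).2 ⟨j, k, (mem_others j k).2 ⟨hkj, hk⟩, rfl⟩)
    rwa [mon_add ha, ← fug, ← fug, mul_comm, ← mul_assoc] at this

/-- A deformation of the fugacities along which every nontrivial monomial with exponents at most `4`
in absolute value moves with nonzero speed: such exponents are digits of balanced base `9`
expansions, so that `∑ mᵢ 9^i` vanishes only for `m = 0`. -/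
noncomputable def deform (a : Fin 4 → ℂ) (t : ℂ) : Fin 4 → ℂ :=
  fun i => a i * Complex.exp (9 ^ (i : ℕ) * t)

lemma deform_ne_zero (ha : ∀ i, a i ≠ 0) (t : ℂ) (i : Fin 4) : deform a t i ≠ 0 :=
  mul_ne_zero (ha i) (Complex.exp_ne_zero _)

lemma tendsto_deform (a : Fin 4 → ℂ) : Tendsto (deform a) (𝓝[≠] 0) (𝓝 a) := by
  have h : Continuous (deform a) := by unfold deform; fun_prop
  have := h.tendsto 0
  rw [show deform a 0 = a by ext; simp [deform]] at this
  exact this.mono_left nhdsWithin_le_nhds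

lemma mon_deform (a : Fin 4 → ℂ) (t : ℂ) (m : Fin 4 → ℤ) :
    mon (deform a t) m = mon a m * Complex.exp ((∑ i, m i * 9 ^ (i : ℕ) : ℤ) * t) := by
  have (i : Fin 4) : deform a t i ^ m i =
      a i ^ m i * Complex.exp ((m i * 9 ^ (i : ℕ) : ℤ) * t) := by
    rw [deform, mul_zpow, ← Complex.exp_int_mul]
    push_cast
    ring_nf
  rw [mon, Finset.prod_congr rfl fun i _ => this i, Finset.prod_mul_distrib, ← Complex.exp_sum,
    ← Finset.sum_mul, Int.cast_sum, mon]

lemma eventually_theta_mul_mon_deform_ne_zero (hq0 : q ≠ 0) (hq : ‖q‖ < 1) (ha : ∀ i, a i ≠ 0)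
    {c : ℂ} (hc : c ≠ 0) {m : Fin 4 → ℤ} (hm : m ≠ 0) (hm4 : ∀ i, |m i| ≤ 4) :
    ∀ᶠ t in 𝓝[≠] (0 : ℂ), theta (c * mon (deform a t) m) q ≠ 0 := by
  have hs : (∑ i, m i * 9 ^ (i : ℕ) : ℤ) ≠ 0 := by
    intro h
    refine hm (funext fun i => ?_)
    simp only [Fin.sum_univ_four, Fin.val_zero, Fin.val_one, Fin.val_two] at h
    have h0 := abs_le.1 (hm4 0)
    have h1 := abs_le.1 (hm4 1)
    have h2 := abs_le.1 (hm4 2)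
    have h3 := abs_le.1 (hm4 3)
    norm_num at h
    fin_cases i <;> simp <;> omega
  have hd : HasDerivAt (fun t : ℂ => Complex.exp ((∑ i, m i * 9 ^ (i : ℕ) : ℤ) * t))
      ((∑ i, m i * 9 ^ (i : ℕ) : ℤ) : ℂ) 0 := by
    simpa using ((hasDerivAt_id (0 : ℂ)).const_mul ((∑ i, m i * 9 ^ (i : ℕ) : ℤ) : ℂ)).cexp
  have ht := hd.tendsto_nhdsNE (Int.cast_ne_zero.2 hs)
  rw [mul_zero, Complex.exp_zero] at ht
  filter_upwards [ht.eventually (eventually_theta_const_mul_ne_zero hq0 hq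
    (mul_ne_zero hc (mon_ne_zero ha m)) one_ne_zero)] with t h
  rwa [mon_deform, ← mul_assoc]

lemma eventually_forall_theta_mul_mon_deform_ne_zero (hq0 : q ≠ 0) (hq : ‖q‖ < 1)
    (ha : ∀ i, a i ≠ 0) {c : ℂ} (hc : c ≠ 0) :
    ∀ᶠ t in 𝓝[≠] (0 : ℂ), ∀ m : Fin 4 → ℤ, (∀ i, |m i| ≤ 4) → (m = 0 → theta c q ≠ 0) →
      theta (c * mon (deform a t) m) q ≠ 0 := by
  have h : ∀ᶠ t in 𝓝[≠] (0 : ℂ), ∀ m ∈ (Fintype.piFinset fun _ : Fin 4 => Finset.Icc (-4 : ℤ) 4),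
      (m = 0 → theta c q ≠ 0) → theta (c * mon (deform a t) m) q ≠ 0 := by
    refine (Finset.eventually_all _).2 fun m hm => ?_
    by_cases hm0 : m = 0
    · simp [hm0, mon_zero]
    · have := eventually_theta_mul_mon_deform_ne_zero hq0 hq ha hc hm0 fun i =>
        abs_le.2 (Finset.mem_Icc.1 (Fintype.mem_piFinset.1 hm i))
      filter_upwards [this] with t ht _ using ht
  filter_upwards [h] with t ht m hm4
  exact ht m (Fintype.mem_piFinset.2 fun i => Finset.mem_Icc.2 (abs_le.1 (hm4 i)))

lemma comp_perm_theta_ne_zero {c : ℂ}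
    (h : ∀ m : Fin 4 → ℤ, (∀ i, |m i| ≤ 4) → theta (c * mon a m) q ≠ 0) (σ : Equiv.Perm (Fin 4))
    (m : Fin 4 → ℤ) (hm : ∀ i, |m i| ≤ 4) : theta (c * mon (a ∘ σ) m) q ≠ 0 := by
  rw [show m = (m ∘ σ.symm) ∘ σ by ext; simp, mon_comp_perm]
  exact h _ fun i => hm _

lemma theta_mul_fug_mul_fug_ne_zero (ha : ∀ i, a i ≠ 0) {c : ℂ}
    (h : ∀ m : Fin 4 → ℤ, (∀ i, |m i| ≤ 4) → theta (c * mon a m) q ≠ 0) (j k : VectorWeight) :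
    theta (c * fug a j * fug a k) q ≠ 0 := by
  rw [mul_assoc, fug, fug, ← mon_add ha]
  refine h _ fun i => ?_
  have := (abs_add_le (j.coords i) (k.coords i)).trans
    (add_le_add (j.abs_coords_le i) (k.abs_coords_le i))
  exact this.trans (by norm_num)

/-- The index is the limit of residue sums at generic fugacities, where triality holds. -/
theorem index_comp_perm (hq0 : q ≠ 0) (hq : ‖q‖ < 1) (hv : v ≠ 0) (ha : ∀ i, a i ≠ 0)
    (hreg : IsRegular a v q) (ε : ℤˣ) (σ : Equiv.Perm (Fin 4)) :
    index ε (a (σ 0)) (a (σ 1)) (a (σ 2)) (a (σ 3)) v q =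
      index ε (a 0) (a 1) (a 2) (a 3) v q := by
  have haσ : ∀ i, (a ∘ σ) i ≠ 0 := fun i => ha _
  have hm : ∀ m ∈ roots, theta (mon a m * v ^ 2) q ≠ 0 := fun m hm => hreg.theta_mon_ne_zero hm
  have hmσ : ∀ m ∈ roots, theta (mon (a ∘ σ) m * v ^ 2) q ≠ 0 := fun m hmr => by
    have := hm _ (comp_perm_mem_roots hmr σ.symm)
    rwa [← mon_comp_perm _ _ σ, show (m ∘ σ.symm) ∘ σ = m by ext; simp] at this
  have hgen : ∀ᶠ t in 𝓝[≠] (0 : ℂ), IsGeneric (deform a t) q ∧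
      ∀ m : Fin 4 → ℤ, (∀ i, |m i| ≤ 4) → theta (v ^ 2 * mon (deform a t) m) q ≠ 0 := by
    filter_upwards [eventually_forall_theta_mul_mon_deform_ne_zero hq0 hq ha one_ne_zero,
      eventually_forall_theta_mul_mon_deform_ne_zero hq0 hq ha (pow_ne_zero 2 hv)] with t h1 h2
    refine ⟨fun m hm0 hm4 => ?_, fun m hm4 => h2 m hm4 fun _ => hreg.zero_weight⟩
    simpa using h1 m hm4 fun h => absurd h hm0
  have hcomp : Tendsto (fun t => deform a t ∘ σ) (𝓝[≠] 0) (𝓝 (a ∘ σ)) :=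
    ((continuous_pi fun i => continuous_apply (σ i)).tendsto a).comp (tendsto_deform a)
  have h1 := tendsto_residueSum ε hq0 hq ha hv
    (theta_sq_mul_fug_mul_fug_ne_zero ha hreg.zero_weight hm)
    (L := map (deform a) (𝓝[≠] 0)) (tendsto_deform a) (eventually_map.2 (hgen.mono fun t ht =>
      ⟨ht.1, theta_mul_fug_mul_fug_ne_zero (deform_ne_zero ha t) ht.2⟩))
  have h2 := tendsto_residueSum ε hq0 hq haσ hv
    (theta_sq_mul_fug_mul_fug_ne_zero haσ hreg.zero_weight hmσ)
    (L := map (fun t => deform a t ∘ σ) (𝓝[≠] 0)) hcomp (eventually_map.2 (hgen.mono fun t ht =>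
      ⟨ht.1.comp_perm σ, theta_mul_fug_mul_fug_ne_zero (fun i => deform_ne_zero ha t (σ i))
        (comp_perm_theta_ne_zero ht.2 σ)⟩))
  rw [tendsto_map'_iff] at h1 h2
  have h3 := tendsto_nhds_unique (h2.congr' ?_) h1
  · exact mul_left_cancel₀ two_ne_zero h3
  · filter_upwards [hgen] with t ht
    refine residueSum_comp_perm hq0 hq (deform_ne_zero ha t) ht.1 σ (pow_ne_zero 2 hv)
      hreg.zero_weight fun m hm => ?_
    rw [mul_comm]
    simp only [roots, Finset.mem_filter, Fintype.mem_piFinset, Finset.mem_Icc] at hm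
    exact ht.2 m fun i => (abs_le.2 (hm.1 i)).trans (by norm_num)

end Deformation

end SQCDIndex

theorem mainTheorem3 (q v : ℂ) (hq0 : q ≠ 0) (hq : ‖q‖ < 1) (hv : v ≠ 0)
    (a : Fin 4 → ℂ) (ha : ∀ i, a i ≠ 0) (hreg : SQCDIndex.IsRegular a v q)
    (ε : ℤˣ) (σ : Equiv.Perm (Fin 4)) :
    SQCDIndex.index ε (a (σ 0)) (a (σ 1)) (a (σ 2)) (a (σ 3)) v q =
      SQCDIndex.index ε (a 0) (a 1) (a 2) (a 3) v q :=
  SQCDIndex.index_comp_perm hq0 hq hv ha hreg ε σ
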